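/- Let $\mathcal H$ be a complex Hilbert space with a complex conjugation $\mathcal C$ (an anti-linear isometry with $\mathcal C^2=\mathbf 1$), and write $\overline A=\mathcal C A\,\mathcal C$. A symmetry operator is a real unitary $S=\overline S$ with $S^2=\mathbf 1$ (even) or $S^2=-\mathbf 1$ (odd), all of whose eigenspaces have the same dimension (so $\mathbf 1$ is an even symmetry operator). For a symmetry operator $S$, an orthogonal projection $P$ is called real if $S^*\overline PS=P$ and Lagrangian if $S^*\overline PS=\mathbf 1-P$. For a bounded Fredholm operator $T$ put $\mathrm{Ind}(T)=\dim\ker T-\dim\ker T^*$ and $\mathrm{Ind}_2(T)=\dim\ker T \bmod 2\in\mathbb Z_2$. Let $P,E$ be orthogonal projections on $\mathcal H$ such that $T=P(\mathbf 1-2E)P+\mathbf 1-P$ is Fredholm, and let $S,\Sigma$ be symmetry operators with $[S,\Sigma]=[\Sigma,P]=[S,E]=0$. The class $j$ specifies the symmetry of $P$: $S^*\overline PS=P$ for $j=0,4$ and $S^*\overline PS=\mathbf 1-P$ for $j=2,6$, with $S^2=\mathbf 1$ for $j=0,2$ and $S^2=-\mathbf 1$ for $j=4,6$. The class $d$ specifies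 the symmetry of $E$: $\Sigma^*\overline E\Sigma=E$ for $d=1,5$ and $\Sigma^*\overline E\Sigma=\mathbf 1-E$ for $d=3,7$, with $\Sigma^2=\mathbf 1$ for $d=1,7$ and $\Sigma^2=-\mathbf 1$ for $d=3,5$. Then the index pairing has the type given by the table $$ \begin{array}{c|cccc} & d=1 & d=3 & d=5 & d=7\\ \hline j=0 & 0 & 0 & 0 & \mathrm{O}\text{-}\mathbb Z_2\\ j=2 & \mathrm{O}\text{-}\mathbb Z_2 & 0 & 0 & 0\\ j=4 & 0 & \mathrm{S}\text{-}\mathbb Z_2 & 0 & 0\\ j=6 & 0 & 0 & \mathrm{S}\text{-}\mathbb Z_2 & 0 \end{array} $$ in the following sense. (a) An entry $\mathbb Z_2$ means that $\mathrm{Ind}(T)=0$ and that $\mathrm{Ind}_2(T)$ is well-defined: it is constant along every norm-continuous path $(P_t,E_t)_{t\in[0,1]}$ with $(P_0,E_0)=(P,E)$ which satisfies all the symmetries of the class $(j,d)$ with the same $\mathcal C,S,\Sigma$ and for which all $T_t=P_t(\mathbf 1-2E_t)P_t+\mathbf 1-P_t$ are Fredholm. The prefix O (respectively S) means that both symmetry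 operators are even (respectively odd), and that one of the two projections is Lagrangian and the other one real, $P$ with respect to $S$ and $E$ with respect to $\Sigma$. (b) An entry $0$ means that $\mathrm{Ind}(T)=0$ and that the pairing is connected to one with trivial $\mathbb Z_2$-index in an augmented Hilbert space: there are $n\ge0$ and symmetry operators $s,\sigma$ and projections $p,e$ on $\mathbb C^n$ (with its standard conjugation) with the symmetries of the same class $(j,d)$ and with $p(\mathbf 1-2e)p+\mathbf 1-p=\mathbf 1$, and there is a norm-continuous path $(\widetilde P_t,\widetilde E_t)_{t\in[0,1]}$ on $\mathcal H\oplus\mathbb C^n$, with the symmetries of the class $(j,d)$ implemented by $S\oplus s$ and $\Sigma\oplus\sigma$ and with all $\widetilde T_t=\widetilde P_t(\mathbf 1-2\widetilde E_t)\widetilde P_t+\mathbf 1-\widetilde P_t$ Fredholm, such that $(\widetilde P_0,\widetilde E_0)=(P\oplus p,E\oplus e)$ (so that $\widetilde T_0=T\oplus\mathbf 1$) and $\mathrm{Ind}_2(\widetilde T_1)=0$. (c) For all the entries $0$ other than those at $(j,d)=(0,1),(2,3),(4,5),(6,7)$, one even has $\mathrm{Ind}_2(T)=0$. -/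

import Mathlib

open scoped ComplexConjugate

noncomputable section

namespace IndexPairing

universe u v

/-! ### Complex conjugations and symmetry operators -/

/-- A complex conjugation on a complex Hilbert space: an anti-linear isometry squaring to `1`. -/
structure ComplexConjugation (H : Type u) [NormedAddCommGroup H] [InnerProductSpace ℂ H] where
  map : H →ₗᵢ⋆[ℂ] H
  map_map : ∀ x, map (map x) = x

section

variable {H : Type u} [NormedAddCommGroup H] [InnerProductSpace ℂ H]

/-- The complex conjugate `C A C` of a bounded operator `A`. -/
def ComplexConjugation.conjOp (C : ComplexConjugation H) (A : H →L[ℂ] H) : H →L[ℂ] H :=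
  C.map.toContinuousLinearMap.comp (A.comp C.map.toContinuousLinearMap)

end

/-- The sign of the square of a symmetry operator: even means `S² = 1`, odd means `S² = -1`. -/
inductive Parity
  | even
  | odd

/-- `S² = 1` for even parity and `S² = -1` for odd parity. -/
def Parity.Squares {H : Type u} [NormedAddCommGroup H] [InnerProductSpace ℂ H] :
    Parity → (H →L[ℂ] H) → Prop
  | .even, S => S * S = 1
  | .odd, S => S * S = -1

section

variable {H : Type u} [NormedAddCommGroup H] [InnerProductSpace ℂ H] [CompleteSpace H]

/-- An even or odd symmetry operator: a real unitary squaring to `1` or `-1` respectively, all of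
whose eigenspaces have the same (Hilbert space) dimension. The identity is an even symmetry
operator, because it has only one eigenspace. -/
structure IsSymmetryOperator (C : ComplexConjugation H) (ε : Parity) (S : H →L[ℂ] H) : Prop where
  unitary : S ∈ unitary (H →L[ℂ] H)
  real : C.conjOp S = S
  squares : ε.Squares S
  eigenspaces : ∀ μ ν : ℂ,
    Module.End.HasEigenvalue (S : H →ₗ[ℂ] H) μ → Module.End.HasEigenvalue (S : H →ₗ[ℂ] H) ν →
    Nonempty (Module.End.eigenspace (S : H →ₗ[ℂ] H) μ ≃ₗᵢ[ℂ]
      Module.End.eigenspace (S : H →ₗ[ℂ] H) ν)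

/-- The two symmetry relations for a projection with respect to a symmetry operator. -/
inductive Relation
  | real
  | lagrangian

/-- A projection `P` is real with respect to `S` if `S* (C P C) S = P`, and Lagrangian with respect
to `S` if `S* (C P C) S = 1 - P`. -/
def Relation.Holds (C : ComplexConjugation H) (S P : H →L[ℂ] H) : Relation → Prop
  | .real => star S * C.conjOp P * S = P
  | .lagrangian => star S * C.conjOp P * S = 1 - P

end

/-! ### The symmetry classes and the table -/

/-- The symmetry classes of `P`. -/
inductive Row
  | j0
  | j2
  | j4
  | j6

/-- The symmetry classes of `E`. -/
inductive Col
  | d1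
  | d3
  | d5
  | d7

/-- The relation imposed on `P`. -/
def Row.relation : Row → Relation
  | .j0 => .real
  | .j2 => .lagrangian
  | .j4 => .real
  | .j6 => .lagrangian

/-- The parity of the symmetry operator `S` of `P`. -/
def Row.parity : Row → Parity
  | .j0 => .even
  | .j2 => .even
  | .j4 => .odd
  | .j6 => .odd

/-- The relation imposed on `E`. -/
def Col.relation : Col → Relation
  | .d1 => .real
  | .d3 => .lagrangian
  | .d5 => .real
  | .d7 => .lagrangian

/-- The parity of the symmetry operator of `E`. -/
def Col.parity : Col → Parity
  | .d1 => .even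
  | .d3 => .odd
  | .d5 => .odd
  | .d7 => .even

/-- The possible entries of the table. -/
inductive Entry
  | zero
  | OZ2
  | SZ2

/-- The table of index types. -/
def table : Row → Col → Entry
  | .j0, .d1 => .zero
  | .j0, .d3 => .zero
  | .j0, .d5 => .zero
  | .j0, .d7 => .OZ2
  | .j2, .d1 => .OZ2
  | .j2, .d3 => .zero
  | .j2, .d5 => .zero
  | .j2, .d7 => .zero
  | .j4, .d1 => .zero
  | .j4, .d3 => .SZ2
  | .j4, .d5 => .zero
  | .j4, .d7 => .zero
  | .j6, .d1 => .zero
  | .j6, .d3 => .zero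
  | .j6, .d5 => .SZ2
  | .j6, .d7 => .zero

/-! ### Index pairings of two projections -/

section

variable {H : Type u} [NormedAddCommGroup H] [InnerProductSpace ℂ H]

/-- The operator `T = P (1 - 2E) P + 1 - P`. -/
def pairing (P E : H →L[ℂ] H) : H →L[ℂ] H :=
  P * (1 - (2 : ℂ) • E) * P + 1 - P

/-- The `ℤ₂`-index, the parity of the nullity. -/
def indTwo (T : H →L[ℂ] H) : ZMod 2 :=
  (Module.finrank ℂ T.ker : ZMod 2)

variable [CompleteSpace H]

/-- The Noether index `dim Ker T - dim Ker T*`. -/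
def ind (T : H →L[ℂ] H) : ℤ :=
  (Module.finrank ℂ T.ker : ℤ) - (Module.finrank ℂ (star T).ker : ℤ)

/-- `P` and `E` are orthogonal projections with the symmetries of the class `(j, d)`, implemented
by the symmetry operators `S` (for `P`) and `R` (for `E`). -/
structure HasSymmetries (C : ComplexConjugation H) (j : Row) (d : Col)
    (S R P E : H →L[ℂ] H) : Prop where
  projP : IsStarProjection P
  projE : IsStarProjection E
  symmS : IsSymmetryOperator C j.parity S
  symmR : IsSymmetryOperator C d.parity R
  commSR : Commute S R
  commRP : Commute R P
  commSE : Commute S E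
  relP : j.relation.Holds C S P
  relE : d.relation.Holds C R E

/-- A norm-continuous path of Fredholm index pairings within the class `(j, d)`, for fixed
complex conjugation and symmetry operators. -/
structure IsPairingPath (C : ComplexConjugation H) (j : Row) (d : Col) (S R : H →L[ℂ] H)
    (P E : unitInterval → (H →L[ℂ] H)) : Prop where
  continuousP : Continuous P
  continuousE : Continuous E
  symmetries : ∀ t, HasSymmetries C j d S R (P t) (E t)
  fredholm : ∀ t, (pairing (P t) (E t)).IsFredholm

/-- One of the two projections is Lagrangian and the other one is real, both with respect to
a symmetry operator of parity `ε`. -/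
def IsLagrangianRealPair (C : ComplexConjugation H) (ε : Parity) (S R P E : H →L[ℂ] H) : Prop :=
  IsSymmetryOperator C ε S ∧ IsSymmetryOperator C ε R ∧
    ((Relation.lagrangian.Holds C S P ∧ Relation.real.Holds C R E) ∨
      (Relation.real.Holds C S P ∧ Relation.lagrangian.Holds C R E))

/-- The `ℤ₂`-index is well-defined, of Lagrangian type with parity `ε`: the Noether index vanishes,
and the `ℤ₂`-index is constant along all homotopies which respect the symmetries and
the Fredholm property. -/
structure HasZ2Index (C : ComplexConjugation H) (j : Row) (d : Col) (ε : Parity)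
    (S R P E : H →L[ℂ] H) : Prop where
  type : IsLagrangianRealPair C ε S R P E
  ind_eq_zero : ind (pairing P E) = 0
  homotopy_invariant : ∀ Pt Et : unitInterval → (H →L[ℂ] H), IsPairingPath C j d S R Pt Et →
    Pt 0 = P → Et 0 = E → ∀ t, indTwo (pairing (Pt t) (Et t)) = indTwo (pairing P E)

end

/-! ### Augmented Hilbert spaces -/

section

variable {H : Type u} [NormedAddCommGroup H] [InnerProductSpace ℂ H]
variable {K : Type v} [NormedAddCommGroup K] [InnerProductSpace ℂ K]

/-- The direct sum `A ⊕ B` of two bounded operators, on the Hilbert space `H ⊕ K`. -/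
def dsum (A : H →L[ℂ] H) (B : K →L[ℂ] K) : WithLp 2 (H × K) →L[ℂ] WithLp 2 (H × K) :=
  ((WithLp.prodContinuousLinearEquiv 2 ℂ H K).symm : H × K →L[ℂ] WithLp 2 (H × K)).comp
    ((A.prodMap B).comp
      ((WithLp.prodContinuousLinearEquiv 2 ℂ H K) : WithLp 2 (H × K) →L[ℂ] H × K))

/-- The direct sum of two complex conjugations. -/
def ComplexConjugation.dsum (C : ComplexConjugation H) (D : ComplexConjugation K) :
    ComplexConjugation (WithLp 2 (H × K)) where
  map :=
    { toFun := fun x => WithLp.toLp 2 (C.map x.fst, D.map x.snd)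
      map_add' := by
        intro x y
        apply (WithLp.prodContinuousLinearEquiv 2 ℂ H K).injective
        simp
      map_smul' := by
        intro c x
        apply (WithLp.prodContinuousLinearEquiv 2 ℂ H K).injective
        simp [map_smulₛₗ]
      norm_map' := by
        intro x
        rw [WithLp.prod_norm_eq_of_L2, WithLp.prod_norm_eq_of_L2]
        simp }
  map_map := by
    intro x
    change WithLp.toLp 2 (C.map (C.map x.fst), D.map (D.map x.snd)) = x
    rw [C.map_map, D.map_map]
    rfl

end

/-- The standard complex conjugation on `ℂⁿ`. -/
def stdConj (n : ℕ) : ComplexConjugation (EuclideanSpace ℂ (Fin n)) where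
  map :=
    { toFun := fun x => WithLp.toLp 2 (fun i => conj (x i))
      map_add' := by
        intro x y
        ext i
        simp
      map_smul' := by
        intro c x
        ext i
        simp
      norm_map' := by
        intro x
        rw [EuclideanSpace.norm_eq, EuclideanSpace.norm_eq]
        simp }
  map_map := by
    intro x
    ext i
    simp

section

variable {H : Type u} [NormedAddCommGroup H] [InnerProductSpace ℂ H] [CompleteSpace H]

/-- The pairing is trivial: its Noether index vanishes and, after adding a pairing
`(p, e)` on some `ℂⁿ` with the same symmetries and with `p (1 - 2e) p + 1 - p = 1`,
so that `T` becomes `T ⊕ 1`, there is a path of index pairings in the class `(j, d)`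
which ends in a pairing with vanishing `ℤ₂`-index. -/
def HasTrivialIndex (C : ComplexConjugation H) (j : Row) (d : Col)
    (S R P E : H →L[ℂ] H) : Prop :=
  ind (pairing P E) = 0 ∧
  ∃ (n : ℕ) (s r p e : EuclideanSpace ℂ (Fin n) →L[ℂ] EuclideanSpace ℂ (Fin n)),
    HasSymmetries (stdConj n) j d s r p e ∧ pairing p e = 1 ∧
    ∃ Pt Et : unitInterval →
        (WithLp 2 (H × EuclideanSpace ℂ (Fin n)) →L[ℂ] WithLp 2 (H × EuclideanSpace ℂ (Fin n))),
      IsPairingPath (C.dsum (stdConj n)) j d (dsum S s) (dsum R r) Pt Et ∧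
      Pt 0 = dsum P p ∧ Et 0 = dsum E e ∧ indTwo (pairing (Pt 1) (Et 1)) = 0

/-- The meaning of an entry of the table for a given pairing. -/
def Entry.IsRealized (C : ComplexConjugation H) (j : Row) (d : Col) (S R P E : H →L[ℂ] H) :
    Entry → Prop
  | .zero => HasTrivialIndex C j d S R P E
  | .OZ2 => HasZ2Index C j d .even S R P E
  | .SZ2 => HasZ2Index C j d .odd S R P E

end

end IndexPairing

end

open scoped ComplexConjugate

noncomputable section

namespace IndexPairing

universe u v

open scoped InnerProductSpace
open Filter Topology

/-! ### Alternating forms -/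

section Alternating

variable {V : Type*} [AddCommGroup V] [Module ℂ V] [FiniteDimensional ℂ V]

/-! Put `F = 1 - 2E`. The operator `T = PFP + 1 - P` is self-adjoint, so its Noether index vanishes,
and its kernel consists of the vectors `x` with `Px = x` and `PFx = 0`. The antiunitary `J = CSR`
has `J² = ±1`, and it either commutes with each projection or exchanges it with its complement.
Hence `K = J` (`P` real) or `K = JF` (`P` Lagrangian) preserves `ker T`, with `K² = ±1` determined
by the class. Three cases arise.

If `K² = -1`, the kernel is quaternionic and so of even dimension
(`indTwo_eq_zero_of_quaternionic`).

If `K² = 1` and exactly one projection is Lagrangian, an antilinear operator anticommutes with `T`.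
Lyapunov-Schmidt reduction to the kernel `N` at a point of a path then gives an alternating form on
`N` whose radical is isomorphic to the nearby kernel. Alternating forms have even rank, so the
parity of the nullity is locally constant (`eventually_indTwo_eq`).

If `K² = 1` and both projections satisfy the same relation, the kernel can be removed. Take a
`K`-invariant unit vector `v` in it and put `w = Fv`, which is orthogonal to the range of `P`.
Rotating `v` towards `w`, after averaging over `R` or `S`, preserves the class, and at least one of
the rotations, of `P` or of `E`, moves `T` on `v` to first order (`exists_first_order`). The nullity
drops, and induction finishes. No extra dimensions are needed, so the augmentation uses `ℂ⁰`. -/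

theorem even_finrank_of_isAlt_of_nondegenerate (B : LinearMap.BilinForm ℂ V) (hB : B.IsAlt)
    (hn : ∀ y, (∀ x, B x y = 0) → y = 0) : Even (Module.finrank ℂ V) := by
  classical
  let b := Module.finBasis ℂ V
  have hdet : (LinearMap.BilinForm.toMatrix b B).det ≠ 0 := by
    rw [← LinearMap.BilinForm.nondegenerate_iff_det_ne_zero b]
    refine ⟨fun x hx => hn x fun y => ?_, fun y hy => hn y fun x => hy x⟩
    rw [← LinearMap.IsAlt.neg hB, hx, neg_zero]
  have htr : (LinearMap.BilinForm.toMatrix b B).transpose = -LinearMap.BilinForm.toMatrix b B := by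
    ext i j
    simp only [Matrix.transpose_apply, Matrix.neg_apply, LinearMap.BilinForm.toMatrix_apply]
    exact (LinearMap.IsAlt.neg hB _ _).symm
  have h := congrArg Matrix.det htr
  rw [Matrix.det_transpose, Matrix.det_neg, Fintype.card_fin] at h
  by_contra hodd
  rw [Nat.not_even_iff_odd] at hodd
  -- A skew-symmetric matrix of odd size satisfies `det = -det`.
  rw [hodd.neg_one_pow, neg_one_mul, self_eq_neg] at h
  exact hdet h

/-- The rank of an alternating bilinear form is even. -/
theorem finrank_ker_of_isAlt (B : LinearMap.BilinForm ℂ V) (hB : B.IsAlt) :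
    (Module.finrank ℂ (LinearMap.ker B) : ZMod 2) = Module.finrank ℂ V := by
  obtain ⟨W, hW⟩ := Submodule.exists_isCompl (LinearMap.ker B)
  have hker : ∀ k ∈ LinearMap.ker B, ∀ x, B x k = 0 := fun k hk x => by
    rw [← LinearMap.IsAlt.neg hB, LinearMap.mem_ker.1 hk, LinearMap.zero_apply, neg_zero]
  -- On a complement of its radical the form is nondegenerate.
  have heven : Even (Module.finrank ℂ W) := by
    refine even_finrank_of_isAlt_of_nondegenerate (B.domRestrict₁₂ W W) (fun x => hB x) ?_
    intro y hy
    have : (y : V) ∈ LinearMap.ker B ⊓ W := by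
      refine ⟨LinearMap.mem_ker.2 (LinearMap.ext fun z => ?_), y.2⟩
      have hz : z ∈ LinearMap.ker B ⊔ W := by rw [hW.sup_eq_top]; trivial
      obtain ⟨k, hk, w, hw, rfl⟩ := Submodule.mem_sup.1 hz
      have hyw : B w y = 0 := hy ⟨w, hw⟩
      rw [map_add, hker k hk, ← LinearMap.IsAlt.neg hB, hyw]
      simp
    rw [hW.inf_eq_bot] at this
    exact Subtype.ext ((Submodule.mem_bot ℂ).1 this)
  rw [← Submodule.finrank_add_eq_of_isCompl hW, Nat.cast_add,
    (ZMod.natCast_eq_zero_iff_even).2 heven, add_zero]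

end Alternating

/-! ### Self-adjoint Fredholm operators and their kernels under perturbation -/

section Fredholm

variable {H : Type u} [NormedAddCommGroup H] [InnerProductSpace ℂ H] [CompleteSpace H]

theorem range_eq_orthogonal_ker {T : H →L[ℂ] H} (hT : IsSelfAdjoint T)
    (hF : T.IsFredholm) : T.range = T.kerᗮ := by
  have h := T.orthogonal_ker
  rw [ContinuousLinearMap.isSelfAdjoint_iff'.1 hT] at h
  rw [h, hF.isClosed_range.submodule_topologicalClosure_eq]

/-- Adding the projection onto the kernel makes a self-adjoint Fredholm operator invertible. -/
theorem isUnit_add_starProjection_ker {T : H →L[ℂ] H} (hT : IsSelfAdjoint T)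
    (hF : T.IsFredholm) (N : Submodule ℂ H) [FiniteDimensional ℂ N] (hN : N = T.ker) :
    IsUnit (T + N.starProjection) := by
  have hr : T.range = Nᗮ := by rw [hN]; exact range_eq_orthogonal_ker hT hF
  have hTN : ∀ x ∈ N, T x = 0 := fun x hx => by rw [hN] at hx; exact hx
  rw [ContinuousLinearMap.isUnit_iff_bijective]
  constructor
  · rw [injective_iff_map_eq_zero]
    intro x hx
    have hx' : T x + N.starProjection x = 0 := hx
    have h1 : T x ∈ Nᗮ := hr ▸ LinearMap.mem_range_self _ x
    have h2 : N.starProjection x ∈ N := N.starProjection_apply_mem x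
    have h3 : ⟪N.starProjection x, N.starProjection x⟫_ℂ = 0 := by
      have := h1 _ h2
      rw [eq_neg_of_add_eq_zero_left hx', inner_neg_right, neg_eq_zero] at this
      exact this
    rw [inner_self_eq_zero] at h3
    rw [h3, add_zero] at hx'
    have h4 : x ∈ N := by rw [hN]; exact hx'
    rw [← N.starProjection_eq_self_iff.2 h4, h3]
  · intro y
    have h1 : y - N.starProjection y ∈ T.range := by
      rw [hr]; exact N.sub_starProjection_mem_orthogonal y
    obtain ⟨z, hz⟩ := h1
    have hz' : T z = y - N.starProjection y := hz
    refine ⟨z - N.starProjection z + N.starProjection y, ?_⟩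
    have e1 : T (N.starProjection z) = 0 := hTN _ (N.starProjection_apply_mem z)
    have e2 : T (N.starProjection y) = 0 := hTN _ (N.starProjection_apply_mem y)
    have e3 : ∀ w, N.starProjection (N.starProjection w) = N.starProjection w := fun w =>
      N.starProjection_eq_self_iff.2 (N.starProjection_apply_mem w)
    simp only [add_apply, map_add, map_sub, e1, e2, e3, hz']
    abel

omit [CompleteSpace H] in
-- The inverse of `T + N.starProjection` inverts `T` up to operators of finite rank.
theorem isFredholm_of_isUnit_add_starProjection {T : H →L[ℂ] H} (N : Submodule ℂ H)
    [FiniteDimensional ℂ N] (hU : IsUnit (T + N.starProjection)) : T.IsFredholm := by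
  obtain ⟨⟨V, R, hVR, hRV⟩, hV⟩ := hU
  simp only at hV
  subst hV
  have hf : N.starProjection.toLinearMap.HasNoetherianRange := by
    rw [LinearMap.hasNoetherianRange_iff_range, N.range_starProjection]
    infer_instance
  refine ContinuousLinearMap.IsFredholm.of_isQuasiInverse (v := R) ⟨?_, ?_⟩
  · refine LinearMap.FiniteRangeSetoid.equiv_iff_hasNoetherianRange.2 ?_
    have : (R.toLinearMap ∘ₗ T.toLinearMap - LinearMap.id) =
        (-R.toLinearMap) ∘ₗ N.starProjection.toLinearMap := by
      ext x
      have := congrArg (fun A : H →L[ℂ] H => A x) hRV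
      simp only [mul_apply_eq_comp, add_apply, map_add,
        one_apply_eq_self] at this
      simp only [LinearMap.sub_apply, LinearMap.comp_apply, LinearMap.neg_apply,
        ContinuousLinearMap.coe_coe, LinearMap.id_apply]
      rw [sub_eq_iff_eq_add, neg_add_eq_sub, eq_sub_iff_add_eq]
      exact this
    exact this ▸ (hf).comp_left _
  · refine LinearMap.FiniteRangeSetoid.equiv_iff_hasNoetherianRange.2 ?_
    have : (T.toLinearMap ∘ₗ R.toLinearMap - LinearMap.id) =
        N.starProjection.toLinearMap ∘ₗ (-R.toLinearMap) := by
      ext x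
      have := congrArg (fun A : H →L[ℂ] H => A x) hVR
      simp only [mul_apply_eq_comp, add_apply,
        one_apply_eq_self] at this
      simp only [LinearMap.sub_apply, LinearMap.comp_apply, LinearMap.neg_apply,
        ContinuousLinearMap.coe_coe, LinearMap.id_apply, map_neg]
      rw [sub_eq_iff_eq_add, neg_add_eq_sub, eq_sub_iff_add_eq]
      exact this
    exact this ▸ (hf).comp_right _

/-- Self-adjoint Fredholm operators stay Fredholm under small perturbations. -/
theorem eventually_isFredholm {X : Type*} [TopologicalSpace X] {T : X → (H →L[ℂ] H)} {x₀ : X}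
    (hc : ContinuousAt T x₀) (hT : IsSelfAdjoint (T x₀)) (hF : (T x₀).IsFredholm) :
    ∀ᶠ x in 𝓝 x₀, (T x).IsFredholm := by
  have := hF.finite_ker
  have hu := isUnit_add_starProjection_ker hT hF (T x₀).ker rfl
  have hc' : ContinuousAt (fun x => T x + (T x₀).ker.starProjection) x₀ :=
    hc.add continuousAt_const
  filter_upwards [hc'.eventually (Units.isOpen.mem_nhds hu)] with x hx
  exact isFredholm_of_isUnit_add_starProjection _ hx

/-! ### Reduction of the kernel to a fixed finite-dimensional space -/

section Reduction

variable {T R : H →L[ℂ] H} {N : Submodule ℂ H} [FiniteDimensional ℂ N]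

omit [CompleteSpace H] in
theorem apply_inverse_mem (h : (T + N.starProjection) * R = 1) {n : H} (hn : n ∈ N) :
    T (R n) ∈ N := by
  have := congrArg (fun A : H →L[ℂ] H => A n) h
  simp only [mul_apply_eq_comp, add_apply,
    one_apply_eq_self] at this
  rw [eq_sub_of_add_eq this]
  exact N.sub_mem hn (N.starProjection_apply_mem _)

omit [CompleteSpace H] in
theorem inverse_starProjection_eq (h : R * (T + N.starProjection) = 1) {x : H} (hx : T x = 0) :
    R (N.starProjection x) = x := by
  have := congrArg (fun A : H →L[ℂ] H => A x) h
  simpa [hx] using this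

omit [CompleteSpace H] in
-- Lyapunov-Schmidt reduction: a solution of `T x = 0` satisfies `x = R n`, where `n` is the
-- projection of `x` to `N`. The kernel is therefore the injective image under `R` of those `n` in
-- `N` with `T (R n) = 0`.
theorem finrank_ker_eq (h : (T + N.starProjection) * R = 1) (h' : R * (T + N.starProjection) = 1)
    (K : Submodule ℂ N) (hK : ∀ n : N, n ∈ K ↔ T (R n) = 0) :
    Module.finrank ℂ T.ker = Module.finrank ℂ K := by
  let f : K →ₗ[ℂ] H := R.toLinearMap ∘ₗ N.subtype ∘ₗ K.subtype
  have hinj : Function.Injective f := by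
    have : Function.Injective R := by
      apply Function.LeftInverse.injective (g := fun x => (T + N.starProjection) x)
      exact fun x => congrArg (fun A : H →L[ℂ] H => A x) h
    exact this.comp (N.subtype_injective.comp K.subtype_injective)
  have hrange : LinearMap.range f = T.ker := by
    ext x
    constructor
    · rintro ⟨n, rfl⟩
      exact (hK n.1).1 n.2
    · intro hx
      have hx' := inverse_starProjection_eq h' hx
      refine ⟨⟨⟨N.starProjection x, N.starProjection_apply_mem x⟩, (hK _).2 ?_⟩, hx'⟩
      change T (R (N.starProjection x)) = 0
      rw [hx']
      exact hx
  rw [← hrange, LinearMap.finrank_range_of_inj hinj]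

end Reduction

/-! ### Local constancy of the parity of the nullity -/

omit [CompleteSpace H] in
/-- An antilinear isometry reverses inner products. -/
theorem inner_antilinear (J : H →ₗᵢ⋆[ℂ] H) (x y : H) :
    ⟪J x, J y⟫_ℂ = ⟪y, x⟫_ℂ := by
  have hn : ∀ z : H, ‖J z‖ = ‖z‖ := J.norm_map
  have e1 : ‖J x + J y‖ = ‖y + x‖ := by rw [← map_add, hn, add_comm]
  have e2 : ‖J x - J y‖ = ‖y - x‖ := by rw [← map_sub, hn, norm_sub_rev]
  have e3 : ‖J x - Complex.I • J y‖ = ‖y - Complex.I • x‖ := by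
    have : J x - Complex.I • J y = J (x + Complex.I • y) := by
      rw [map_add, map_smulₛₗ]; simp [sub_eq_add_neg]
    rw [this, hn]
    have : x + Complex.I • y = Complex.I • (y - Complex.I • x) := by
      rw [smul_sub, smul_smul, Complex.I_mul_I]; simp [add_comm]
    rw [this, norm_smul]; simp
  have e4 : ‖J x + Complex.I • J y‖ = ‖y + Complex.I • x‖ := by
    have : J x + Complex.I • J y = J (x - Complex.I • y) := by
      rw [map_sub, map_smulₛₗ]; simp
    rw [this, hn]
    have : x - Complex.I • y = (-Complex.I) • (y + Complex.I • x) := by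
      rw [smul_add, smul_smul, neg_mul, Complex.I_mul_I]; simp [sub_eq_add_neg, add_comm]
    rw [this, norm_smul]; simp
  simp only [inner_eq_sum_norm_sq_div_four]
  simp only [RCLike.I_to_complex]
  rw [e1, e2, e3, e4]

/-- The form `(m, n) ↦ ⟪J B R m, T R n⟫` on `N` is bilinear because `J` is antilinear, and
alternating because `J B` is symmetric and anticommutes with `T`. As `T R` maps `N` into `N`, the
condition `hnd` identifies its radical with the reduced kernel, and the rank of the form is even. -/
theorem indTwo_eq_of_antilinear (J : H →ₗᵢ⋆[ℂ] H) {T B R : H →L[ℂ] H} (N : Submodule ℂ H)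
    [FiniteDimensional ℂ N] (hT : IsSelfAdjoint T)
    (h : (T + N.starProjection) * R = 1) (h' : R * (T + N.starProjection) = 1)
    (symm : ∀ x y, ⟪J (B x), y⟫_ℂ = ⟪J (B y), x⟫_ℂ)
    (anti : ∀ x, J (B (T x)) = -T (J (B x)))
    (hnd : ∀ n ∈ N, n ≠ 0 → ∃ m ∈ N, ⟪J (B (R m)), n⟫_ℂ ≠ 0) :
    indTwo T = (Module.finrank ℂ N : ZMod 2) := by
  have hsym := hT.isSymmetric
  let ω : LinearMap.BilinForm ℂ N := LinearMap.mk₂ ℂ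
    (fun m n : N => ⟪J (B (R m)), T (R n)⟫_ℂ)
    (by intro a b c; simp)
    (by intro c a b; simp [map_smulₛₗ, mul_comm])
    (by intro a b c; simp)
    (by intro c a b; simp)
  have hω : ∀ m n : N, ω m n = ⟪J (B (R m)), T (R n)⟫_ℂ := fun _ _ => rfl
  have halt : ω.IsAlt := by
    intro n
    rw [hω]
    have h1 : ⟪J (B (R n)), T (R n)⟫_ℂ = ⟪T (J (B (R n))), R n⟫_ℂ :=
      (hsym _ _).symm
    have h2 : T (J (B (R n))) = - J (B (T (R n))) := by rw [anti, neg_neg]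
    rw [h2, inner_neg_left, symm] at h1
    rw [symm] at h1
    exact self_eq_neg.1 h1
  rw [indTwo, ← finrank_ker_of_isAlt ω halt]
  congr 1
  refine finrank_ker_eq h h' _ fun n => ?_
  constructor
  · intro hn
    by_contra hne
    obtain ⟨m, hm, hm'⟩ := hnd _ (apply_inverse_mem h n.2) hne
    apply hm'
    rw [← hω ⟨m, hm⟩ n, ← LinearMap.IsAlt.neg halt, LinearMap.mem_ker.1 hn]
    simp
  · intro hn
    refine LinearMap.mem_ker.2 (LinearMap.ext fun m => ?_)
    rw [← LinearMap.IsAlt.neg halt, hω, hn, inner_zero_right, neg_zero, LinearMap.zero_apply]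

/-- At `x₀` the operator `J B` is an involution of the kernel `N`, and the inverse of `T +
N.starProjection` fixes `N`. The nondegeneracy required by `indTwo_eq_of_antilinear` thus holds at
`x₀`, and it survives small perturbations. -/
theorem eventually_indTwo_eq {X : Type*} [TopologicalSpace X] (J : H →ₗᵢ⋆[ℂ] H)
    {T B : X → (H →L[ℂ] H)} {x₀ : X} (hTc : ContinuousAt T x₀) (hBc : ContinuousAt B x₀)
    (hT : ∀ x, IsSelfAdjoint (T x)) (hF : (T x₀).IsFredholm)
    (symm : ∀ t x y, ⟪J (B t x), y⟫_ℂ = ⟪J (B t y), x⟫_ℂ)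
    (anti : ∀ t x, J (B t (T t x)) = -T t (J (B t x)))
    (inv : ∀ n, T x₀ n = 0 → J (B x₀ (J (B x₀ n))) = n) :
    ∀ᶠ x in 𝓝 x₀, indTwo (T x) = indTwo (T x₀) := by
  have := hF.finite_ker
  set N := (T x₀).ker with hN
  have hu := isUnit_add_starProjection_ker (hT x₀) hF N hN
  have hc : ContinuousAt (fun x => T x + N.starProjection) x₀ := hTc.add continuousAt_const
  have hR : ContinuousAt (fun x => B x * Ring.inverse (T x + N.starProjection)) x₀ := by
    refine hBc.mul (ContinuousAt.comp (g := Ring.inverse)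
      (f := fun x => T x + N.starProjection) ?_ hc)
    obtain ⟨U, hU⟩ := hu
    rw [← hU]
    exact NormedRing.inverse_continuousAt U
  -- The witness `m` below has norm at most `‖B x₀‖ * ‖n‖`, so this radius keeps the error strictly
  -- below `‖n‖`.
  have hδ : 0 < (1 : ℝ) / (‖B x₀‖ + 1) := by positivity
  have hclose := Metric.continuousAt_iff'.1 hR _ hδ
  filter_upwards [hc.eventually (Units.isOpen.mem_nhds hu), hclose] with t ht hd
  have r1 := Ring.mul_inverse_cancel _ ht
  have r2 := Ring.inverse_mul_cancel _ ht
  rw [indTwo_eq_of_antilinear J N (hT t) r1 r2 (symm t) (anti t) ?_]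
  · rfl
  intro n hn hne
  set m := J (B x₀ n) with hm
  have hTn : T x₀ n = 0 := hn
  have hmN : T x₀ m = 0 := by
    have := anti x₀ n
    rw [hTn] at this
    simpa using this.symm
  refine ⟨m, hmN, ?_⟩
  set R := Ring.inverse (T t + N.starProjection)
  set R₀ := Ring.inverse (T x₀ + N.starProjection) with hR₀
  have hR₀m : R₀ m = m := by
    have := congrArg (fun A : H →L[ℂ] H => A m) (Ring.inverse_mul_cancel _ hu)
    simp only [mul_apply_eq_comp, add_apply,
      one_apply_eq_self, hmN, zero_add] at this
    rwa [N.starProjection_eq_self_iff.2 (show m ∈ N from hmN)] at this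
  set z := J (B t (R m)) with hz
  have hdist : ‖z - n‖ < ‖n‖ := by
    have e : z - n = J ((B t * R - B x₀ * R₀) m) := by
      conv_lhs => rw [hz, ← inv n hTn]
      rw [← map_sub]
      congr 1
      change B t (R m) - B x₀ m = B t (R m) - B x₀ (R₀ m)
      rw [hR₀m]
    rw [e, J.norm_map]
    rw [dist_eq_norm] at hd
    have hnpos : 0 < ‖n‖ := norm_pos_iff.2 hne
    have hmle : ‖m‖ ≤ ‖B x₀‖ * ‖n‖ := by
      rw [hm, J.norm_map]
      exact (B x₀).le_opNorm n
    calc ‖(B t * R - B x₀ * R₀) m‖ ≤ ‖B t * R - B x₀ * R₀‖ * ‖m‖ :=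
          ContinuousLinearMap.le_opNorm _ _
      _ ≤ 1 / (‖B x₀‖ + 1) * (‖B x₀‖ * ‖n‖) := by gcongr
      _ < ‖n‖ := by
          rw [div_mul_eq_mul_div, one_mul, div_lt_iff₀ (by positivity)]
          nlinarith
  intro h0
  -- If `z` were orthogonal to `n`, Cauchy-Schwarz would give `‖n‖ ≤ ‖z - n‖`.
  have h1 : ⟪z - n, n⟫_ℂ = -((‖n‖ : ℂ) ^ 2) := by
    rw [inner_sub_left, h0, zero_sub, inner_self_eq_norm_sq_to_K]; rfl
  have h2 := norm_inner_le_norm (𝕜 := ℂ) (z - n) n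
  rw [h1, norm_neg, norm_pow, Complex.norm_real, norm_norm] at h2
  have hnpos : 0 < ‖n‖ := norm_pos_iff.2 hne
  nlinarith

/-- A first-order perturbation which does not vanish on the kernel reduces the kernel. -/
theorem eventually_finrank_ker_lt {T : ℝ → (H →L[ℂ] H)} {D : H →L[ℂ] H} (hD : HasDerivAt T D 0)
    (hT : ∀ t, IsSelfAdjoint (T t)) (hF : (T 0).IsFredholm) {v : H} (hv : T 0 v = 0)
    (hDv : ⟪v, D v⟫_ℂ ≠ 0) :
    ∀ᶠ t in 𝓝[≠] (0 : ℝ), Module.finrank ℂ (T t).ker < Module.finrank ℂ (T 0).ker := by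
  have := hF.finite_ker
  set N := (T 0).ker with hN
  have hvN : v ∈ N := hv
  have hu := isUnit_add_starProjection_ker (hT 0) hF N hN
  have hc : ContinuousAt (fun x => T x + N.starProjection) 0 :=
    hD.continuousAt.add continuousAt_const
  have hR : ContinuousAt (fun x => Ring.inverse (T x + N.starProjection) v) 0 := by
    refine ContinuousAt.clm_apply (ContinuousAt.comp (g := Ring.inverse)
      (f := fun x => T x + N.starProjection) ?_ hc) continuousAt_const
    obtain ⟨U, hU⟩ := hu
    rw [← hU]
    exact NormedRing.inverse_continuousAt U
  have hR0 : Ring.inverse (T 0 + N.starProjection) v = v := by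
    have := congrArg (fun A : H →L[ℂ] H => A v) (Ring.inverse_mul_cancel _ hu)
    simp only [mul_apply_eq_comp, add_apply,
      one_apply_eq_self, hv, zero_add] at this
    rwa [N.starProjection_eq_self_iff.2 hvN] at this
  have hslope : Tendsto (fun t : ℝ => t⁻¹ • T t v) (𝓝[≠] 0) (𝓝 (D v)) := by
    have := hasDerivAt_iff_tendsto_slope.1
      (((ContinuousLinearMap.apply ℂ H v).restrictScalars ℝ).hasFDerivAt.comp_hasDerivAt 0 hD)
    simpa [slope_fun_def, hv] using this
  have hlim : Tendsto (fun t : ℝ => ⟪t⁻¹ • T t v, Ring.inverse (T t + N.starProjection) v⟫_ℂ)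
      (𝓝[≠] 0) (𝓝 ⟪D v, v⟫_ℂ) := by
    refine Tendsto.inner hslope ?_
    have h := hR.tendsto
    rw [hR0] at h
    exact h.mono_left nhdsWithin_le_nhds
  have hne : ⟪D v, v⟫_ℂ ≠ 0 := by
    rw [← inner_conj_symm]; exact (map_ne_zero _).2 hDv
  filter_upwards [hlim.eventually_ne hne,
    nhdsWithin_le_nhds (hc.eventually (Units.isOpen.mem_nhds hu))] with t ht hunit
  have r1 := Ring.mul_inverse_cancel _ hunit
  have r2 := Ring.inverse_mul_cancel _ hunit
  set R := Ring.inverse (T t + N.starProjection)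
  let K : Submodule ℂ N := LinearMap.ker ((T t).toLinearMap ∘ₗ R.toLinearMap ∘ₗ N.subtype)
  rw [finrank_ker_eq r1 r2 K fun n => Iff.rfl]
  -- If `v` lay in the reduced kernel, then `⟪T t v, R v⟫ = ⟪v, T t (R v)⟫ = 0`, although its
  -- quotient by `t` stays near `⟪D v, v⟫ ≠ 0`.
  refine Submodule.finrank_lt fun htop => ?_
  have hvK : (⟨v, hvN⟩ : N) ∈ K := by rw [htop]; trivial
  have hvK' : T t (R v) = 0 := hvK
  apply ht
  have : ⟪T t v, R v⟫_ℂ = 0 := by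
    have := (hT t).isSymmetric v (R v)
    simp only [ContinuousLinearMap.coe_coe] at this
    rw [this, hvK', inner_zero_right]
  rw [← Complex.coe_smul, inner_smul_left, this, mul_zero]

end Fredholm

section Pairing

variable {H : Type u} [NormedAddCommGroup H] [InnerProductSpace ℂ H] [CompleteSpace H]

/-! ### Kernels of index pairings -/

/-- The self-adjoint unitary `1 - 2E`. -/
def signOp (E : H →L[ℂ] H) : H →L[ℂ] H := 1 - (2 : ℂ) • E

omit [CompleteSpace H] in
theorem signOp_apply (E : H →L[ℂ] H) (x : H) : signOp E x = x - (2 : ℂ) • E x := rfl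

omit [CompleteSpace H] in
theorem pairing_apply (P E : H →L[ℂ] H) (x : H) :
    pairing P E x = P (signOp E (P x)) + x - P x := rfl

theorem proj_proj {P : H →L[ℂ] H} (hP : IsStarProjection P) (x : H) : P (P x) = P x :=
  congrArg (fun A : H →L[ℂ] H => A x) hP.isIdempotentElem

theorem signOp_signOp {E : H →L[ℂ] H} (hE : IsStarProjection E) (x : H) :
    signOp E (signOp E x) = x := by
  simp only [signOp_apply, map_sub, map_smul, proj_proj hE]
  module

theorem isSelfAdjoint_signOp {E : H →L[ℂ] H} (hE : IsStarProjection E) :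
    IsSelfAdjoint (signOp E) := by
  rw [IsSelfAdjoint, signOp, star_sub, star_one, star_smul, hE.isSelfAdjoint.star_eq]
  simp

theorem isSelfAdjoint_pairing {P E : H →L[ℂ] H} (hP : IsStarProjection P)
    (hE : IsStarProjection E) : IsSelfAdjoint (pairing P E) := by
  change IsSelfAdjoint (P * signOp E * P + 1 - P)
  rw [IsSelfAdjoint]
  simp [mul_assoc, hP.isSelfAdjoint.star_eq, (isSelfAdjoint_signOp hE).star_eq]

theorem ind_pairing {P E : H →L[ℂ] H} (hP : IsStarProjection P)
    (hE : IsStarProjection E) : ind (pairing P E) = 0 := by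
  rw [ind, (isSelfAdjoint_pairing hP hE).star_eq, sub_self]

theorem pairing_apply_eq_zero_iff {P E : H →L[ℂ] H} (hP : IsStarProjection P) (x : H) :
    pairing P E x = 0 ↔ P x = x ∧ P (signOp E x) = 0 := by
  rw [pairing_apply]
  constructor
  · intro h
    have h1 : P x = x := by
      have h2 : x = P (x - signOp E (P x)) := by
        rw [map_sub]
        rw [← sub_eq_zero, ← h]
        abel
      rw [h2, proj_proj hP]
    rw [h1] at h
    exact ⟨h1, by simpa using h⟩
  · rintro ⟨h1, h2⟩
    rw [h1, h2]
    simp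

/-! ### The antiunitary symmetry of an index pairing -/

/-- Commutation relation of a projection with an antiunitary `J`: it commutes with `J` in the real
case, and is exchanged with its complement in the Lagrangian case. -/
def Relation.Commutes (J : H →ₗᵢ⋆[ℂ] H) (P : H →L[ℂ] H) : Relation → Prop
  | .real => ∀ x, J (P x) = P (J x)
  | .lagrangian => ∀ x, J (P x) = J x - P (J x)

/-- The antiunitary `C U` for a unitary `U`. -/
def ComplexConjugation.antiunitary (C : ComplexConjugation H) (U : H →L[ℂ] H)
    (hU : U ∈ unitary (H →L[ℂ] H)) : H →ₗᵢ⋆[ℂ] H where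
  toLinearMap := C.map.toLinearMap.comp (U : H →ₗ[ℂ] H)
  norm_map' x := by
    change ‖C.map (U x)‖ = ‖x‖
    rw [C.map.norm_map]
    exact ContinuousLinearMap.norm_map_of_mem_unitary hU x

theorem ComplexConjugation.antiunitary_apply (C : ComplexConjugation H) {U : H →L[ℂ] H}
    (hU : U ∈ unitary (H →L[ℂ] H)) (x : H) : C.antiunitary U hU x = C.map (U x) := rfl

omit [CompleteSpace H] in
theorem ComplexConjugation.conjOp_apply (C : ComplexConjugation H) (A : H →L[ℂ] H) (x : H) :
    C.conjOp A x = C.map (A (C.map x)) := rfl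

theorem Relation.Holds.commutes {C : ComplexConjugation H} {S P : H →L[ℂ] H} {r : Relation}
    (hS : S ∈ unitary (H →L[ℂ] H)) (h : r.Holds C S P) : r.Commutes (C.antiunitary S hS) P := by
  have hSS := (Unitary.mem_iff.1 hS).2
  cases r with
  | real =>
    intro x
    have h1 : S * (star S * C.conjOp P * S) = S * P := congrArg (S * ·) h
    rw [← mul_assoc, ← mul_assoc, hSS, one_mul] at h1
    have h2 : C.map (P (C.map (S x))) = S (P x) := congrArg (fun A : H →L[ℂ] H => A x) h1
    rw [C.antiunitary_apply, C.antiunitary_apply, ← h2, C.map_map]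
  | lagrangian =>
    intro x
    have h1 : S * (star S * C.conjOp P * S) = S * (1 - P) := congrArg (S * ·) h
    rw [← mul_assoc, ← mul_assoc, hSS, one_mul] at h1
    have h2 : C.map (P (C.map (S x))) = S (x - P x) := congrArg (fun A : H →L[ℂ] H => A x) h1
    rw [C.antiunitary_apply, C.antiunitary_apply]
    rw [map_sub, eq_sub_iff_add_eq, ← eq_sub_iff_add_eq'] at h2
    rw [h2, map_sub, C.map_map]

/-- Since `R` commutes with `P`, passing from `C S` to `C S R` costs nothing. By symmetry `E` is
treated alike, so a single antiunitary controls both projections. -/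
theorem Relation.Commutes.mul_right {C : ComplexConjugation H} {S R P : H →L[ℂ] H} {r : Relation}
    (hS : S ∈ unitary (H →L[ℂ] H)) (hSR : S * R ∈ unitary (H →L[ℂ] H)) (hR : Commute R P)
    (h : r.Commutes (C.antiunitary S hS) P) : r.Commutes (C.antiunitary (S * R) hSR) P := by
  have hRP : ∀ x, R (P x) = P (R x) := fun x => congrArg (fun A : H →L[ℂ] H => A x) hR.eq
  cases r with
  | real =>
    intro x
    change C.map (S (R (P x))) = _
    rw [hRP]
    exact h (R x)
  | lagrangian =>
    intro x
    change C.map (S (R (P x))) = _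
    rw [hRP]
    exact h (R x)

/-- The sign of the square of a symmetry operator. -/
def Parity.sign : Parity → ℂ
  | .even => 1
  | .odd => -1

theorem Parity.sign_mul_self (ε : Parity) : ε.sign * ε.sign = 1 := by
  cases ε <;> simp [Parity.sign]

omit [CompleteSpace H] in
theorem Parity.Squares.apply_apply {ε : Parity} {S : H →L[ℂ] H} (h : ε.Squares S) (x : H) :
    S (S x) = ε.sign • x := by
  cases ε with
  | even => simpa [Parity.sign] using congrArg (fun A : H →L[ℂ] H => A x) h
  | odd => simpa [Parity.sign] using congrArg (fun A : H →L[ℂ] H => A x) h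

theorem IsSymmetryOperator.map_comm {C : ComplexConjugation H} {ε : Parity} {S : H →L[ℂ] H}
    (h : IsSymmetryOperator C ε S) (x : H) : C.map (S x) = S (C.map x) := by
  have := congrArg (fun A : H →L[ℂ] H => A (C.map x)) h.real
  simpa [C.conjOp_apply, C.map_map] using this

namespace HasSymmetries

variable {C : ComplexConjugation H} {j : Row} {d : Col} {S R P E : H →L[ℂ] H}

theorem mem_unitary (h : HasSymmetries C j d S R P E) : S * R ∈ unitary (H →L[ℂ] H) :=
  mul_mem h.symmS.unitary h.symmR.unitary

/-- The antiunitary `C S R` attached to the pair of symmetry operators. -/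
def antiunitary (h : HasSymmetries C j d S R P E) : H →ₗᵢ⋆[ℂ] H :=
  C.antiunitary (S * R) h.mem_unitary

theorem antiunitary_apply (h : HasSymmetries C j d S R P E) (x : H) :
    h.antiunitary x = C.map (S (R x)) := rfl

theorem commutesP (h : HasSymmetries C j d S R P E) :
    j.relation.Commutes h.antiunitary P :=
  (h.relP.commutes h.symmS.unitary).mul_right _ _ h.commRP

theorem commutesE (h : HasSymmetries C j d S R P E) :
    d.relation.Commutes h.antiunitary E := by
  have hSR : R * S ∈ unitary (H →L[ℂ] H) := mul_mem h.symmR.unitary h.symmS.unitary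
  have := (h.relE.commutes h.symmR.unitary).mul_right h.symmR.unitary hSR h.commSE
  have e : h.antiunitary = C.antiunitary (R * S) hSR := by
    ext x
    change C.map ((S * R) x) = C.map ((R * S) x)
    rw [h.commSR.eq]
  rwa [e]

theorem antiunitary_antiunitary (h : HasSymmetries C j d S R P E) (x : H) :
    h.antiunitary (h.antiunitary x) = (j.parity.sign * d.parity.sign) • x := by
  have hSR : ∀ x, S (R x) = R (S x) := fun x => congrArg (fun A : H →L[ℂ] H => A x) h.commSR.eq
  rw [h.antiunitary_apply, h.antiunitary_apply, h.symmS.map_comm, h.symmR.map_comm,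
    C.map_map, ← hSR (R x), h.symmR.squares.apply_apply,
    map_smul, map_smul, h.symmS.squares.apply_apply, smul_smul, mul_comm]

end HasSymmetries

omit [CompleteSpace H] in
theorem Relation.Commutes.signOp_real {J : H →ₗᵢ⋆[ℂ] H} {E : H →L[ℂ] H}
    (h : Relation.real.Commutes J E) (x : H) : J (signOp E x) = signOp E (J x) := by
  have := h x
  simp only [signOp_apply, map_sub, map_smulₛₗ, this, map_ofNat]

omit [CompleteSpace H] in
theorem Relation.Commutes.signOp_lagrangian {J : H →ₗᵢ⋆[ℂ] H} {E : H →L[ℂ] H}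
    (h : Relation.lagrangian.Commutes J E) (x : H) : J (signOp E x) = -signOp E (J x) := by
  have := h x
  simp only [signOp_apply, map_sub, map_smulₛₗ, this]
  simp only [map_ofNat]
  module

/-! ### Quaternionic structures on the kernel -/

omit [CompleteSpace H] in
/-- A kernel with a quaternionic structure has even dimension. -/
theorem indTwo_eq_zero_of_quaternionic {T : H →L[ℂ] H} [FiniteDimensional ℂ T.ker]
    (θ : H →ₗ⋆[ℂ] H) (hθ : ∀ x y, ⟪θ x, θ y⟫_ℂ = ⟪y, x⟫_ℂ)
    (hker : ∀ x, T x = 0 → T (θ x) = 0) (hsq : ∀ x, T x = 0 → θ (θ x) = -x) :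
    indTwo T = 0 := by
  let ω : LinearMap.BilinForm ℂ T.ker := LinearMap.mk₂ ℂ
    (fun m n : T.ker => ⟪θ m, n⟫_ℂ)
    (by intro a b c; simp)
    (by intro c a b; simp [map_smulₛₗ, mul_comm])
    (by intro a b c; simp)
    (by intro c a b; simp)
  have hω : ∀ m n : T.ker, ω m n = ⟪θ m, n⟫_ℂ := fun _ _ => rfl
  rw [indTwo, ZMod.natCast_eq_zero_iff_even]
  refine even_finrank_of_isAlt_of_nondegenerate ω ?_ ?_
  · intro x
    rw [hω]
    -- Antiunitarity with `θ² = -1` makes `⟪θ x, x⟫` equal to its own negative.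
    have h1 := hθ x (θ x)
    rw [hsq x x.2, inner_neg_right] at h1
    exact self_eq_neg.1 h1.symm
  · intro y hy
    have h1 := hy ⟨θ y, hker y y.2⟩
    rw [hω] at h1
    simp only [hsq y y.2, inner_neg_left, neg_eq_zero, inner_self_eq_zero] at h1
    exact Subtype.ext h1

/-- The antilinear symmetry which acts on the kernel of the index pairing: `J` if `P` is real, and
`J (1 - 2E)` if `P` is Lagrangian. -/
def kernelSymmetry (J : H →ₗᵢ⋆[ℂ] H) (E : H →L[ℂ] H) : Relation → (H →ₗ⋆[ℂ] H)
  | .real => J.toLinearMap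
  | .lagrangian => J.toLinearMap.comp (signOp E : H →ₗ[ℂ] H)

/-- The sign picked up by the square of `kernelSymmetry`. -/
def Relation.kernelSign : Relation → Relation → ℂ
  | .real, _ => 1
  | .lagrangian, .real => 1
  | .lagrangian, .lagrangian => -1

section KernelSymmetry

variable {J : H →ₗᵢ⋆[ℂ] H} {P E : H →L[ℂ] H} {r r' : Relation}

theorem inner_kernelSymmetry (hE : IsStarProjection E) (x y : H) :
    ⟪kernelSymmetry J E r x, kernelSymmetry J E r y⟫_ℂ = ⟪y, x⟫_ℂ := by
  cases r with
  | real => exact inner_antilinear J x y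
  | lagrangian =>
    refine (inner_antilinear J (signOp E x) (signOp E y)).trans ?_
    have := (isSelfAdjoint_signOp hE).isSymmetric y (signOp E x)
    simp only [ContinuousLinearMap.coe_coe] at this
    rw [this, signOp_signOp hE]

/-- For Lagrangian `P`, a kernel vector `x` has `signOp E x` in the range of `1 - P`, which `J` maps
back into the range of `P`. -/
theorem kernelSymmetry_mem_ker (hP : IsStarProjection P) (hE : IsStarProjection E)
    (hJP : r.Commutes J P) (hJE : r'.Commutes J E) {x : H} (hx : pairing P E x = 0) :
    pairing P E (kernelSymmetry J E r x) = 0 := by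
  rw [pairing_apply_eq_zero_iff hP] at hx ⊢
  obtain ⟨h1, h2⟩ := hx
  cases r with
  | real =>
    change P (J x) = J x ∧ P (signOp E (J x)) = 0
    have hJP' : ∀ x, J (P x) = P (J x) := hJP
    refine ⟨by rw [← hJP', h1], ?_⟩
    cases r' with
    | real => rw [← hJE.signOp_real, ← hJP', h2, map_zero]
    | lagrangian =>
      rw [← neg_eq_zero, ← map_neg, ← hJE.signOp_lagrangian, ← hJP', h2, map_zero]
  | lagrangian =>
    change P (J (signOp E x)) = J (signOp E x) ∧ P (signOp E (J (signOp E x))) = 0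
    have hJP' : ∀ x, P (J x) = J x - J (P x) := fun x => by
      rw [hJP x]; abel
    refine ⟨by rw [hJP', h2, map_zero, sub_zero], ?_⟩
    cases r' with
    | real => rw [← hJE.signOp_real, signOp_signOp hE, hJP', h1, sub_self]
    | lagrangian =>
      rw [← neg_eq_zero, ← map_neg, ← hJE.signOp_lagrangian, signOp_signOp hE, hJP', h1, sub_self]

theorem kernelSymmetry_kernelSymmetry (hE : IsStarProjection E) (hJE : r'.Commutes J E)
    {c : ℂ} (hJ : ∀ x, J (J x) = c • x) (x : H) :
    kernelSymmetry J E r (kernelSymmetry J E r x) = (c * r.kernelSign r') • x := by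
  cases r with
  | real => rw [Relation.kernelSign, mul_one]; exact hJ x
  | lagrangian =>
    change J (signOp E (J (signOp E x))) = _
    cases r' with
    | real => simp [hJE.signOp_real, signOp_signOp hE, hJ, Relation.kernelSign]
    | lagrangian =>
      have : signOp E (J (signOp E x)) = - J x := by
        rw [← neg_eq_iff_eq_neg, ← hJE.signOp_lagrangian, signOp_signOp hE]
      simp [this, hJ, Relation.kernelSign]

end KernelSymmetry

namespace HasSymmetries

variable {C : ComplexConjugation H} {j : Row} {d : Col} {S R P E : H →L[ℂ] H}

/-- The square of the antilinear symmetry of the kernel in the class `(j, d)`. -/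
theorem kernelSymmetry_sq (h : HasSymmetries C j d S R P E) (x : H) :
    kernelSymmetry h.antiunitary E j.relation (kernelSymmetry h.antiunitary E j.relation x) =
      (j.parity.sign * d.parity.sign * j.relation.kernelSign d.relation) • x :=
  kernelSymmetry_kernelSymmetry h.projE h.commutesE h.antiunitary_antiunitary x

theorem indTwo_eq_zero (h : HasSymmetries C j d S R P E) (hF : (pairing P E).IsFredholm)
    (hs : j.parity.sign * d.parity.sign * j.relation.kernelSign d.relation = -1) :
    indTwo (pairing P E) = 0 := by
  have := hF.finite_ker
  refine indTwo_eq_zero_of_quaternionic (kernelSymmetry h.antiunitary E j.relation)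
    (inner_kernelSymmetry h.projE)
    (fun x hx => kernelSymmetry_mem_ker h.projP h.projE h.commutesP h.commutesE hx) fun x _ => ?_
  rw [h.kernelSymmetry_sq, hs, neg_one_smul]

end HasSymmetries

/-! ### Homotopy invariance -/

/-- The linear part of the antilinear operator anticommuting with the index pairing. -/
def antilinearPart (U P E : H →L[ℂ] H) : Relation → (H →L[ℂ] H)
  | .real => U * P
  | .lagrangian => U * (1 - P) * signOp E * P

omit [CompleteSpace H] in
theorem continuous_signOp : Continuous (signOp : (H →L[ℂ] H) → (H →L[ℂ] H)) := by
  unfold signOp; fun_prop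

theorem continuous_pairing {X : Type*} [TopologicalSpace X] {P E : X → (H →L[ℂ] H)}
    (hP : Continuous P) (hE : Continuous E) : Continuous fun x => pairing (P x) (E x) := by
  unfold pairing; fun_prop

theorem continuous_antilinearPart {X : Type*} [TopologicalSpace X] {P E : X → (H →L[ℂ] H)}
    (hP : Continuous P) (hE : Continuous E) (U : H →L[ℂ] H) (r : Relation) :
    Continuous fun x => antilinearPart U (P x) (E x) r := by
  cases r with
  | real => exact continuous_const.mul hP
  | lagrangian =>
    exact ((continuous_const.mul (continuous_const.sub hP)).mul
      (continuous_signOp.comp hE)).mul hP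

/-! ### Antilinear operators anticommuting with the pairing -/

section Antilinear

variable {J : H →ₗᵢ⋆[ℂ] H} {P E : H →L[ℂ] H}

omit [CompleteSpace H] in
theorem inner_J_comm (hJ : ∀ x, J (J x) = x) (x y : H) : ⟪J x, y⟫_ℂ = ⟪J y, x⟫_ℂ := by
  rw [← inner_antilinear J, hJ]

theorem inner_proj_comm (hP : IsStarProjection P) (x y : H) : ⟪P x, y⟫_ℂ = ⟪x, P y⟫_ℂ :=
  hP.isSelfAdjoint.isSymmetric x y

theorem inner_signOp_comm (hE : IsStarProjection E) (x y : H) :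
    ⟪signOp E x, y⟫_ℂ = ⟪x, signOp E y⟫_ℂ :=
  (isSelfAdjoint_signOp hE).isSymmetric x y

theorem antilinear_symm_real (hP : IsStarProjection P) (hJ : ∀ x, J (J x) = x)
    (hJP : Relation.real.Commutes J P) (x y : H) : ⟪J (P x), y⟫_ℂ = ⟪J (P y), x⟫_ℂ := by
  rw [inner_J_comm hJ, ← inner_proj_comm hP, hJP y]

theorem antilinear_anti_real (hP : IsStarProjection P)
    (hJP : Relation.real.Commutes J P) (hJE : Relation.lagrangian.Commutes J E) (x : H) :
    J (P (pairing P E x)) = -pairing P E (J (P x)) := by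
  have hJP' : ∀ x, J (P x) = P (J x) := hJP
  simp only [pairing_apply, map_add, map_sub, proj_proj hP, hJP', hJE.signOp_lagrangian]
  simp

theorem antilinear_symm_lagrangian (hP : IsStarProjection P) (hE : IsStarProjection E)
    (hJ : ∀ x, J (J x) = x) (hJP : Relation.lagrangian.Commutes J P)
    (hJE : Relation.real.Commutes J E) (x y : H) :
    ⟪J (signOp E (P x) - P (signOp E (P x))), y⟫_ℂ =
      ⟪J (signOp E (P y) - P (signOp E (P y))), x⟫_ℂ := by
  have key : ∀ z, J (z - P z) = P (J z) := fun z => by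
    rw [map_sub, hJP z]; abel
  rw [key, key, inner_proj_comm hP, inner_proj_comm hP, inner_J_comm hJ, ← inner_signOp_comm hE,
    hJE.signOp_real]

/-- With `F = signOp E`, the antilinear operator is `J (1 - P) F P = P J F P`. The anticommutation
rests on `F² = 1` and on `P J P = 0`. -/
theorem antilinear_anti_lagrangian (hP : IsStarProjection P) (hE : IsStarProjection E)
    (hJP : Relation.lagrangian.Commutes J P) (hJE : Relation.real.Commutes J E) (x : H) :
    J (signOp E (P (pairing P E x)) - P (signOp E (P (pairing P E x)))) =
      -pairing P E (J (signOp E (P x) - P (signOp E (P x)))) := by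
  have key : ∀ z, J (z - P z) = P (J z) := fun z => by
    rw [map_sub, hJP z]; abel
  have key' : ∀ z, P (J z) = J z - J (P z) := fun z => by
    rw [hJP z]; abel
  rw [key, key, pairing_apply]
  simp only [pairing_apply, map_add, map_sub, proj_proj hP, ← hJE.signOp_real, key',
    signOp_signOp hE]
  abel

end Antilinear

/-- The classes for which the kernel carries a skew-symmetric structure. -/
inductive IsSkewClass : Row → Col → Prop
  | of_real {j d} : j.relation = .real → d.relation = .lagrangian →
      j.parity.sign * d.parity.sign = 1 → IsSkewClass j d
  | of_lagrangian {j d} : j.relation = .lagrangian → d.relation = .real →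
      j.parity.sign * d.parity.sign = 1 → IsSkewClass j d

/-- In the skew classes, the parity of the nullity is constant along paths. -/
theorem IsPairingPath.indTwo_eq {C : ComplexConjugation H} {j : Row} {d : Col} {S R : H →L[ℂ] H}
    {P E : unitInterval → (H →L[ℂ] H)} (h : IsPairingPath C j d S R P E) (hs : IsSkewClass j d)
    (t t' : unitInterval) : indTwo (pairing (P t) (E t)) = indTwo (pairing (P t') (E t')) := by
  refine IsLocallyConstant.apply_eq_of_preconnectedSpace
    (f := fun t => indTwo (pairing (P t) (E t))) ?_ t t'
  rw [IsLocallyConstant.iff_eventually_eq]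
  intro t₀
  let J : H →ₗᵢ⋆[ℂ] H := (h.symmetries t₀).antiunitary
  have hTc : Continuous fun t => pairing (P t) (E t) := continuous_pairing h.continuousP h.continuousE
  have hBc := continuous_antilinearPart h.continuousP h.continuousE (S * R) j.relation
  have hsa := fun t => isSelfAdjoint_pairing (h.symmetries t).projP (h.symmetries t).projE
  have hJP : ∀ t, j.relation.Commutes J (P t) := fun t => (h.symmetries t).commutesP
  have hJE : ∀ t, d.relation.Commutes J (E t) := fun t => (h.symmetries t).commutesE
  have hJJ : ∀ x, J (J x) = (j.parity.sign * d.parity.sign) • x :=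
    (h.symmetries t₀).antiunitary_antiunitary
  -- The antiunitary is split into `C.map` and the linear factor `S * R`, which is absorbed into
  -- `antilinearPart`.
  refine eventually_indTwo_eq C.map hTc.continuousAt hBc.continuousAt hsa (h.fredholm t₀) ?_ ?_ ?_
  · intro t x y
    cases hs with
    | of_real hj hd hsgn =>
      rw [hsgn] at hJJ
      rw [hj] at hJP ⊢
      exact antilinear_symm_real (h.symmetries t).projP (fun x => by rw [hJJ, one_smul]) (hJP t) x y
    | of_lagrangian hj hd hsgn =>
      rw [hsgn] at hJJ
      rw [hj] at hJP ⊢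
      rw [hd] at hJE
      exact antilinear_symm_lagrangian (h.symmetries t).projP (h.symmetries t).projE
        (fun x => by rw [hJJ, one_smul]) (hJP t) (hJE t) x y
  · intro t x
    cases hs with
    | of_real hj hd hsgn =>
      rw [hj] at hJP ⊢
      rw [hd] at hJE
      exact antilinear_anti_real (h.symmetries t).projP (hJP t) (hJE t) x
    | of_lagrangian hj hd hsgn =>
      rw [hj] at hJP ⊢
      rw [hd] at hJE
      exact antilinear_anti_lagrangian (h.symmetries t).projP (h.symmetries t).projE
        (hJP t) (hJE t) x
  · intro n hn
    have hn' := (pairing_apply_eq_zero_iff (h.symmetries t₀).projP n).1 hn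
    have hm := (pairing_apply_eq_zero_iff (h.symmetries t₀).projP _).1
      (kernelSymmetry_mem_ker (h.symmetries t₀).projP (h.symmetries t₀).projE (hJP t₀) (hJE t₀) hn)
    have hsq := (h.symmetries t₀).kernelSymmetry_sq n
    cases hs with
    | of_real hj hd hsgn =>
      rw [hsgn, hj, Relation.kernelSign, one_mul, one_smul] at hsq
      rw [hj] at hm ⊢
      change J (P t₀ (J (P t₀ n))) = n
      rw [hn'.1]
      have h1 : P t₀ (J n) = J n := hm.1
      rw [h1]
      exact hsq
    | of_lagrangian hj hd hsgn =>
      rw [hsgn, hj, hd, Relation.kernelSign, one_mul, one_smul] at hsq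
      rw [hj] at hm ⊢
      have key : ∀ m, P t₀ m = m → P t₀ (signOp (E t₀) m) = 0 →
          J (signOp (E t₀) (P t₀ m) - P t₀ (signOp (E t₀) (P t₀ m))) = J (signOp (E t₀) m) := by
        intro m h1 h2
        rw [h1, h2, sub_zero]
      change J (signOp (E t₀) (P t₀ (J (signOp (E t₀) (P t₀ n) -
        P t₀ (signOp (E t₀) (P t₀ n))))) - P t₀ (signOp (E t₀) (P t₀ (J (signOp (E t₀) (P t₀ n) -
        P t₀ (signOp (E t₀) (P t₀ n))))))) = n
      rw [key n hn'.1 hn'.2]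
      exact (key _ hm.1 hm.2).trans hsq

end Pairing

section Deformation

variable {H : Type u} [NormedAddCommGroup H] [InnerProductSpace ℂ H] [CompleteSpace H]

/-! ### Rotations by one-parameter unitary groups -/

/-- The automorphism `A ↦ S* (C A C) S`. -/
def symmHom (C : ComplexConjugation H) (S : H →L[ℂ] H) (hS : S ∈ unitary (H →L[ℂ] H)) :
    (H →L[ℂ] H) →+* (H →L[ℂ] H) where
  toFun A := star S * C.conjOp A * S
  map_one' := by
    have : C.conjOp (1 : H →L[ℂ] H) = 1 := by ext x; simp [C.conjOp_apply, C.map_map]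
    rw [this, mul_one, (Unitary.mem_iff.1 hS).1]
  map_mul' A B := by
    have e : C.conjOp (A * B) = C.conjOp A * C.conjOp B := by
      ext x; simp [C.conjOp_apply, C.map_map]
    have hSS := (Unitary.mem_iff.1 hS).2
    rw [e]
    calc star S * (C.conjOp A * C.conjOp B) * S
        = star S * C.conjOp A * 1 * C.conjOp B * S := by simp only [mul_assoc, one_mul]
      _ = _ := by rw [← hSS]; simp only [mul_assoc]
  map_zero' := by
    have : C.conjOp (0 : H →L[ℂ] H) = 0 := by ext x; simp [C.conjOp_apply]
    rw [this]; simp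
  map_add' A B := by
    have e : C.conjOp (A + B) = C.conjOp A + C.conjOp B := by
      ext x; simp [C.conjOp_apply]
    rw [e, mul_add, add_mul]

theorem continuous_symmHom (C : ComplexConjugation H) (S : H →L[ℂ] H)
    (hS : S ∈ unitary (H →L[ℂ] H)) : Continuous (symmHom C S hS) := by
  refine AddMonoidHomClass.continuous_of_bound (symmHom C S hS) 1 fun A => ?_
  rw [one_mul]
  refine ContinuousLinearMap.opNorm_le_bound _ (norm_nonneg _) fun x => ?_
  have hS' : star S ∈ unitary (H →L[ℂ] H) := Unitary.star_mem hS
  change ‖star S (C.map (A (C.map (S x))))‖ ≤ _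
  rw [ContinuousLinearMap.norm_map_of_mem_unitary hS', C.map.norm_map]
  refine (A.le_opNorm _).trans_eq ?_
  rw [C.map.norm_map, ContinuousLinearMap.norm_map_of_mem_unitary hS]

theorem Relation.Holds.iff_symmHom {C : ComplexConjugation H} {S : H →L[ℂ] H}
    (hS : S ∈ unitary (H →L[ℂ] H)) (P : H →L[ℂ] H) (r : Relation) :
    r.Holds C S P ↔ symmHom C S hS P = match r with | .real => P | .lagrangian => 1 - P := by
  cases r <;> rfl

/-- The conjugate of `P` by the unitary `exp (t B)`. -/
def rotate (B P : H →L[ℂ] H) (t : ℝ) : H →L[ℂ] H :=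
  NormedSpace.exp (t • B) * P * NormedSpace.exp (t • -B)

variable {B P : H →L[ℂ] H}

theorem exp_neg_mul_exp (B : H →L[ℂ] H) (t : ℝ) :
    NormedSpace.exp (t • -B) * NormedSpace.exp (t • B) = 1 := by
  let : NormedAlgebra ℚ (H →L[ℂ] H) := NormedAlgebra.restrictScalars ℚ ℂ _
  rw [← NormedSpace.exp_add_of_commute, smul_neg, neg_add_cancel, NormedSpace.exp_zero]
  rw [smul_neg]
  exact (Commute.refl _).neg_left

theorem rotate_zero : rotate B P 0 = P := by
  simp [rotate]

theorem hasDerivAt_rotate (B P : H →L[ℂ] H) : HasDerivAt (rotate B P) (B * P - P * B) 0 := by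
  have h1 : HasDerivAt (fun t : ℝ => NormedSpace.exp (t • B)) B 0 := by
    simpa using hasDerivAt_exp_smul_const B (0 : ℝ)
  have h2 : HasDerivAt (fun t : ℝ => NormedSpace.exp (t • -B)) (-B) 0 := by
    simpa using hasDerivAt_exp_smul_const (-B) (0 : ℝ)
  have h3 := (h1.mul_const P).mul h2
  refine h3.congr_deriv ?_
  simp [sub_eq_add_neg]

theorem continuous_rotate (B P : H →L[ℂ] H) : Continuous (rotate B P) := by
  have h : ∀ A : H →L[ℂ] H, Continuous fun t : ℝ => NormedSpace.exp (t • A) := fun A =>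
    (differentiable_exp_smul_const ℝ A).continuous
  exact ((h B).mul continuous_const).mul (h (-B))

theorem isStarProjection_rotate (hB : star B = -B) (hP : IsStarProjection P) (t : ℝ) :
    IsStarProjection (rotate B P t) := by
  constructor
  · have hP' : P * P = P := hP.isIdempotentElem
    change rotate B P t * rotate B P t = rotate B P t
    calc rotate B P t * rotate B P t = NormedSpace.exp (t • B) * P *
          (NormedSpace.exp (t • -B) * NormedSpace.exp (t • B)) * P * NormedSpace.exp (t • -B) := by
          simp only [rotate, mul_assoc]
      _ = NormedSpace.exp (t • B) * (P * P) * NormedSpace.exp (t • -B) := by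
          rw [exp_neg_mul_exp]; simp only [mul_assoc, one_mul]
      _ = rotate B P t := by rw [hP']; rfl
  · rw [IsSelfAdjoint, rotate, star_mul, star_mul, NormedSpace.star_exp, NormedSpace.star_exp,
      star_smul, star_smul,
      star_neg, hB, hP.isSelfAdjoint.star_eq, neg_neg, star_trivial, mul_assoc]

theorem commute_rotate {R : H →L[ℂ] H} (hB : Commute R B) (hP : Commute R P) (t : ℝ) :
    Commute R (rotate B P t) :=
  (((hB.smul_right t).exp_right).mul_right hP).mul_right ((hB.neg_right.smul_right t).exp_right)

/-- A continuous ring homomorphism commutes with `exp`; although `symmHom` is antilinear, it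
respects the real parameter `t`. -/
theorem symmHom_rotate {C : ComplexConjugation H} {S : H →L[ℂ] H}
    (hS : S ∈ unitary (H →L[ℂ] H)) (hB : symmHom C S hS B = B) (t : ℝ) :
    symmHom C S hS (rotate B P t) = rotate B (symmHom C S hS P) t := by
  let : NormedAlgebra ℚ (H →L[ℂ] H) := NormedAlgebra.restrictScalars ℚ ℂ _
  have hc := continuous_symmHom C S hS
  rw [rotate, map_mul, map_mul, NormedSpace.map_exp _ hc, NormedSpace.map_exp _ hc,
    map_real_smul _ hc, map_real_smul _ hc, map_neg, hB]
  rfl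

theorem rotate_one_sub (t : ℝ) : rotate B (1 - P) t = 1 - rotate B P t := by
  have h := exp_neg_mul_exp (-B) t
  rw [neg_neg] at h
  rw [rotate, mul_sub, sub_mul, mul_one, h]
  rfl

theorem Relation.Holds.rotate {C : ComplexConjugation H} {S : H →L[ℂ] H} {r : Relation}
    (hS : S ∈ unitary (H →L[ℂ] H)) (hB : symmHom C S hS B = B) (h : r.Holds C S P) (t : ℝ) :
    r.Holds C S (rotate B P t) := by
  rw [iff_symmHom hS] at h ⊢
  rw [symmHom_rotate hS hB, h]
  cases r with
  | real => rfl
  | lagrangian => exact rotate_one_sub t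

section

variable {C : ComplexConjugation H} {j : Row} {d : Col} {S R E : H →L[ℂ] H}

theorem HasSymmetries.rotateP (h : HasSymmetries C j d S R P E) (hskew : star B = -B)
    (hR : Commute R B) (hB : symmHom C S h.symmS.unitary B = B) (t : ℝ) :
    HasSymmetries C j d S R (rotate B P t) E :=
  { h with
    projP := isStarProjection_rotate hskew h.projP t
    commRP := commute_rotate hR h.commRP t
    relP := h.relP.rotate h.symmS.unitary hB t }

theorem HasSymmetries.rotateE (h : HasSymmetries C j d S R P E) (hskew : star B = -B)
    (hS : Commute S B) (hB : symmHom C R h.symmR.unitary B = B) (t : ℝ) :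
    HasSymmetries C j d S R P (rotate B E t) :=
  { h with
    projE := isStarProjection_rotate hskew h.projE t
    commSE := commute_rotate hS h.commSE t
    relE := h.relE.rotate h.symmR.unitary hB t }

end

/-! ### Generators of symmetric rotations -/

/-- The skew-adjoint operator rotating `v` into `w`. -/
def planeRotation (v w : H) : H →L[ℂ] H :=
  InnerProductSpace.rankOne ℂ w v - InnerProductSpace.rankOne ℂ v w

omit [CompleteSpace H] in
theorem planeRotation_apply (v w x : H) :
    planeRotation v w x = ⟪v, x⟫_ℂ • w - ⟪w, x⟫_ℂ • v := rfl

theorem star_planeRotation (v w : H) : star (planeRotation v w) = -planeRotation v w := by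
  rw [planeRotation, star_sub, ContinuousLinearMap.star_eq_adjoint,
    ContinuousLinearMap.star_eq_adjoint, InnerProductSpace.adjoint_rankOne,
    InnerProductSpace.adjoint_rankOne, neg_sub]

/-- The average of `planeRotation v w` over the symmetry operator `R`. -/
def generator (R : H →L[ℂ] H) (v w : H) : H →L[ℂ] H :=
  planeRotation v w + R * planeRotation v w * star R

theorem star_generator (R : H →L[ℂ] H) (v w : H) : star (generator R v w) = -generator R v w := by
  simp only [generator, star_add, star_mul, star_planeRotation, star_star, mul_neg, neg_mul,
    neg_add, mul_assoc]

theorem IsSymmetryOperator.star_eq {C : ComplexConjugation H} {ε : Parity} {R : H →L[ℂ] H}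
    (h : IsSymmetryOperator C ε R) : star R = ε.sign • R := by
  have h1 := (Unitary.mem_iff.1 h.unitary).1
  have h2 : R * R = ε.sign • 1 := by
    ext x
    exact h.squares.apply_apply x
  calc star R = star R * ((ε.sign * ε.sign) • 1) := by rw [ε.sign_mul_self, one_smul, mul_one]
    _ = ε.sign • (star R * (R * R)) := by rw [h2, mul_smul, mul_smul_comm, mul_smul_comm]
    _ = ε.sign • R := by rw [← mul_assoc, h1, one_mul]

/-- As `R² = ±1`, conjugation by `R` exchanges the two summands. -/
theorem commute_generator {C : ComplexConjugation H} {ε : Parity} {R : H →L[ℂ] H}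
    (h : IsSymmetryOperator C ε R) (v w : H) : Commute R (generator R v w) := by
  have h2 : R * R = ε.sign • 1 := by
    ext x
    exact h.squares.apply_apply x
  change R * _ = _ * R
  simp only [generator, h.star_eq, mul_add, add_mul, mul_smul_comm, smul_mul_assoc, mul_assoc, h2,
    mul_one]
  rw [← mul_assoc R R, h2, smul_mul_assoc, one_mul, smul_smul, smul_smul, ε.sign_mul_self, one_smul,
    one_smul, add_comm]

theorem Parity.conj_sign (ε : Parity) : conj ε.sign = ε.sign := by
  cases ε <;> simp [Parity.sign]

/-- The plane rotation commutes with `C S R`, so conjugation by `C S` acts on it as conjugation by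
`R` does: it swaps the two summands of the generator. -/
theorem symmHom_generator {C : ComplexConjugation H} {ε ε' : Parity} {S R : H →L[ℂ] H}
    (hS : IsSymmetryOperator C ε S) (hR : IsSymmetryOperator C ε' R) (hSR : Commute S R) {v w : H}
    (hJ : ∀ x, C.map (S (R (planeRotation v w x))) = planeRotation v w (C.map (S (R x)))) :
    symmHom C S hS.unitary (generator R v w) = generator R v w := by
  have hSR' : ∀ x, S (R x) = R (S x) := fun x => congrArg (fun A : H →L[ℂ] H => A x) hSR.eq
  have hg : ∀ x, generator R v w x =
      planeRotation v w x + ε'.sign • R (planeRotation v w (R x)) := fun x => by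
    rw [generator, hR.star_eq]
    simp
  have key : ∀ x, generator R v w (C.map (S x)) = C.map (S (generator R v w x)) := by
    intro x
    have e1 : planeRotation v w (C.map (S x)) =
        ε'.sign • C.map (S (R (planeRotation v w (R x)))) := by
      have : C.map (S x) = ε'.sign • C.map (S (R (R x))) := by
        rw [hR.squares.apply_apply, map_smul, map_smulₛₗ, ε'.conj_sign, smul_smul,
          ε'.sign_mul_self, one_smul]
      rw [this, map_smul, hJ]
    have e2 : R (planeRotation v w (R (C.map (S x)))) =
        ε'.sign • C.map (S (planeRotation v w x)) := by
      rw [← hR.map_comm, ← hSR', ← hJ, ← hR.map_comm, ← hSR', hR.squares.apply_apply, map_smul,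
        map_smulₛₗ, ε'.conj_sign]
    rw [hg, hg, e1, e2, smul_smul, ε'.sign_mul_self, one_smul, map_add, map_add, map_smul,
      map_smulₛₗ, ε'.conj_sign, add_comm]
  ext x
  change star S (C.map (generator R v w (C.map (S x)))) = _
  rw [key, C.map_map]
  exact congrArg (fun A : H →L[ℂ] H => A (generator R v w x)) (Unitary.mem_iff.1 hS.unitary).1

/-! ### First-order perturbation of the kernel -/

section Perturbation

variable {E : H →L[ℂ] H} {v w : H}

theorem inner_skew {A : H →L[ℂ] H} (hA : star A = -A) (x y : H) : ⟪x, A y⟫_ℂ = -⟪A x, y⟫_ℂ := by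
  rw [← ContinuousLinearMap.adjoint_inner_left, ← ContinuousLinearMap.star_eq_adjoint, hA]
  simp

theorem hasDerivAt_pairing_rotateP (B P E : H →L[ℂ] H) :
    HasDerivAt (fun t => pairing (rotate B P t) E)
      ((B * P - P * B) * signOp E * P + P * signOp E * (B * P - P * B) - (B * P - P * B)) 0 := by
  have h := hasDerivAt_rotate B P
  have h1 := (((h.mul_const (signOp E)).mul h).add_const 1).sub h
  simp only [rotate_zero] at h1
  exact h1

theorem inner_deriv_rotateP (hP : IsStarProjection P) (hE : IsStarProjection E)
    (hB : star B = -B) (hv : P v = v) (hw : P w = 0) (hvw : signOp E v = w) :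
    ⟪v, ((B * P - P * B) * signOp E * P + P * signOp E * (B * P - P * B) -
      (B * P - P * B)) v⟫_ℂ = ((2 * (⟪w, B v⟫_ℂ).re : ℝ) : ℂ) := by
  have e : ((B * P - P * B) * signOp E * P + P * signOp E * (B * P - P * B) - (B * P - P * B)) v =
      (B (P w) - P (B w)) + P (signOp E (B v - P (B v))) - (B v - P (B v)) := by
    simp [hv, hvw]
  have e1 : ⟪v, P (B w)⟫_ℂ = -conj ⟪w, B v⟫_ℂ := by
    rw [← inner_proj_comm hP, hv, inner_skew hB, inner_conj_symm]
  have e2 : ⟪v, P (signOp E (B v - P (B v)))⟫_ℂ = ⟪w, B v⟫_ℂ := by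
    rw [← inner_proj_comm hP, hv, ← inner_signOp_comm hE, hvw, inner_sub_right,
      ← inner_proj_comm hP, hw, inner_zero_left, sub_zero]
  have e3 : ⟪v, B v - P (B v)⟫_ℂ = 0 := by
    rw [inner_sub_right, ← inner_proj_comm hP, hv, sub_self]
  rw [e, hw, map_zero, zero_sub, inner_sub_right, inner_add_right, inner_neg_right, e1, e2, e3,
    neg_neg, sub_zero, add_comm, Complex.add_conj]

theorem hasDerivAt_pairing_rotateE (B P E : H →L[ℂ] H) :
    HasDerivAt (fun t => pairing P (rotate B E t)) (P * (B * signOp E - signOp E * B) * P) 0 := by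
  have h := (((hasDerivAt_rotate B E).const_smul (2 : ℂ)).const_sub (1 : H →L[ℂ] H))
  have h1 := (((h.const_mul P).mul_const P).add_const 1).sub_const P
  have e : B * signOp E - signOp E * B = -((2 : ℂ) • (B * E - E * B)) := by
    simp only [signOp, mul_sub, sub_mul, mul_one, one_mul, mul_smul_comm, smul_mul_assoc, smul_sub]
    abel
  rw [e]
  exact h1

theorem inner_deriv_rotateE (hP : IsStarProjection P) (hE : IsStarProjection E)
    (hB : star B = -B) (hv : P v = v) (hvw : signOp E v = w) :
    ⟪v, (P * (B * signOp E - signOp E * B) * P) v⟫_ℂ = ((-(2 * (⟪w, B v⟫_ℂ).re) : ℝ) : ℂ) := by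
  have e : (P * (B * signOp E - signOp E * B) * P) v = P (B w - signOp E (B v)) := by
    simp [hv, hvw]
  rw [e, ← inner_proj_comm hP, hv, inner_sub_right, ← inner_signOp_comm hE, hvw, inner_skew hB,
    ← inner_conj_symm, Complex.ofReal_neg, ← Complex.add_conj]
  ring

omit [CompleteSpace H] in
-- The equality case of Cauchy-Schwarz.
theorem eq_inner_smul_of_norm_inner_eq_one {x y : H} (hx : ‖x‖ = 1) (hy : ‖y‖ = 1)
    (h : 1 ≤ ‖⟪x, y⟫_ℂ‖) : y = ⟪x, y⟫_ℂ • x := by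
  rw [← sub_eq_zero, ← norm_eq_zero, ← sq_eq_zero_iff]
  have hxx : ⟪x, x⟫_ℂ = 1 := by rw [inner_self_eq_norm_sq_to_K, hx]; simp
  have hyy : ⟪y, y⟫_ℂ = 1 := by rw [inner_self_eq_norm_sq_to_K, hy]; simp
  have h1 : (‖y - ⟪x, y⟫_ℂ • x‖ : ℂ) ^ 2 = ((1 - ‖⟪x, y⟫_ℂ‖ ^ 2 : ℝ) : ℂ) := by
    have := inner_self_eq_norm_sq_to_K (𝕜 := ℂ) (y - ⟪x, y⟫_ℂ • x)
    rw [inner_sub_left, inner_sub_right, inner_sub_right, inner_smul_left, inner_smul_right,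
      inner_smul_left, inner_smul_right, hxx, hyy, ← inner_conj_symm y x] at this
    simp only [RCLike.ofReal_eq_complex_ofReal] at this
    rw [← this, Complex.ofReal_sub, Complex.ofReal_one, Complex.ofReal_pow, ← Complex.conj_mul']
    ring
  have h2 : ‖y - ⟪x, y⟫_ℂ • x‖ ^ 2 = 1 - ‖⟪x, y⟫_ℂ‖ ^ 2 := by exact_mod_cast h1
  have h3 : 1 ≤ ‖⟪x, y⟫_ℂ‖ ^ 2 := one_le_pow₀ h
  nlinarith [sq_nonneg ‖y - ⟪x, y⟫_ℂ • x‖]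

theorem inner_generator (R : H →L[ℂ] H) (hv1 : ‖v‖ = 1) (hw1 : ‖w‖ = 1) (hwv : ⟪w, v⟫_ℂ = 0) :
    ⟪w, generator R v w v⟫_ℂ =
      1 + conj ⟪v, R v⟫_ℂ * ⟪w, R w⟫_ℂ - ⟪R w, v⟫_ℂ * ⟪w, R v⟫_ℂ := by
  have hvv : ⟪v, v⟫_ℂ = 1 := by rw [inner_self_eq_norm_sq_to_K, hv1]; simp
  have hww : ⟪w, w⟫_ℂ = 1 := by rw [inner_self_eq_norm_sq_to_K, hw1]; simp
  have e : generator R v w v =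
      planeRotation v w v + R (planeRotation v w (star R v)) := rfl
  rw [e, planeRotation_apply, planeRotation_apply, ContinuousLinearMap.star_eq_adjoint,
    ContinuousLinearMap.adjoint_inner_right, ContinuousLinearMap.adjoint_inner_right]
  simp only [map_sub, map_smul, inner_add_right, inner_sub_right, inner_smul_right, hvv, hww, hwv,
    inner_conj_symm]
  ring

theorem Complex.eq_neg_of_re_conj_mul_le {a b : ℂ} (ha : ‖a‖ ≤ 1) (hb : ‖b‖ ≤ 1)
    (h : (conj a * b).re ≤ -1) : b = -a ∧ 1 ≤ ‖a‖ := by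
  have ha2 : ‖a‖ ^ 2 ≤ 1 := pow_le_one₀ (norm_nonneg a) ha
  have hb2 : ‖b‖ ^ 2 ≤ 1 := pow_le_one₀ (norm_nonneg b) hb
  have h1 : ‖a + b‖ ^ 2 = ‖a‖ ^ 2 + ‖b‖ ^ 2 + 2 * (conj a * b).re := by
    rw [Complex.sq_norm, Complex.sq_norm, Complex.sq_norm, Complex.normSq_add]
    simp
  have h2 : ‖a + b‖ = 0 := by
    rw [← sq_eq_zero_iff]
    nlinarith [sq_nonneg ‖a + b‖]
  have h3 : b = -a := by
    rw [norm_eq_zero] at h2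
    exact eq_neg_of_add_eq_zero_right h2
  refine ⟨h3, ?_⟩
  rw [h3, mul_neg, Complex.conj_mul', ← Complex.ofReal_pow, Complex.neg_re, Complex.ofReal_re] at h
  nlinarith [norm_nonneg a]

/-- One of the two symmetric rotations moves a kernel vector away from zero to first order. -/
theorem exists_first_order (hP : IsStarProjection P) (hE : IsStarProjection E)
    {S R : H →L[ℂ] H} (hS : S ∈ unitary (H →L[ℂ] H)) (hR : R ∈ unitary (H →L[ℂ] H))
    (hSR : Commute S R) (hRP : Commute R P) (hSE : Commute S E)
    (hv1 : ‖v‖ = 1) (hv : P v = v) (hw : P w = 0) (hvw : signOp E v = w) :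
    (⟪w, generator R v w v⟫_ℂ).re ≠ 0 ∨ (⟪w, generator S v w v⟫_ℂ).re ≠ 0 := by
  have hSR' : ∀ x, S (R x) = R (S x) := fun x => congrArg (fun A : H →L[ℂ] H => A x) hSR.eq
  have hRP' : ∀ x, R (P x) = P (R x) := fun x => congrArg (fun A : H →L[ℂ] H => A x) hRP.eq
  have hSF : ∀ x, S (signOp E x) = signOp E (S x) := fun x => by
    have : S (E x) = E (S x) := congrArg (fun A : H →L[ℂ] H => A x) hSE.eq
    rw [signOp_apply, signOp_apply, map_sub, map_smul, this]
  have hwv : ⟪w, v⟫_ℂ = 0 := by rw [← hv, ← inner_proj_comm hP, hw, inner_zero_left]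
  have hw1 : ‖w‖ = 1 := by
    have : ⟪w, w⟫_ℂ = ⟪v, v⟫_ℂ := by
      rw [← hvw, inner_signOp_comm hE, signOp_signOp hE]
    rw [inner_self_eq_norm_sq_to_K, inner_self_eq_norm_sq_to_K, hv1] at this
    have h2 : ‖w‖ ^ 2 = 1 := by
      have h3 : ‖w‖ ^ 2 = (1 : ℝ) ^ 2 := by exact_mod_cast this
      rw [h3, one_pow]
    nlinarith [norm_nonneg w]
  have hbound : ∀ U ∈ unitary (H →L[ℂ] H), ∀ x y : H, ‖x‖ = 1 → ‖y‖ = 1 → ‖⟪x, U y⟫_ℂ‖ ≤ 1 := by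
    intro U hU x y hx hy
    refine (norm_inner_le_norm _ _).trans ?_
    rw [ContinuousLinearMap.norm_map_of_mem_unitary hU, hx, hy, one_mul]
  rw [inner_generator R hv1 hw1 hwv, inner_generator S hv1 hw1 hwv]
  -- If both first-order terms vanish, all Cauchy-Schwarz bounds are attained: `R v = a v`, `R w =
  -- -a w` and `S v = c w` with `a, c ≠ 0`. Then `S R v = a c w` but `R S v = -a c w`, against
  -- commutativity.
  by_contra! hcon
  obtain ⟨c1, c2⟩ := hcon
  have hRwv : ⟪R w, v⟫_ℂ = 0 := by
    rw [← hv, ← inner_proj_comm hP, ← hRP', hw, map_zero, inner_zero_left]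
  rw [hRwv, zero_mul, sub_zero, Complex.add_re, Complex.one_re] at c1
  obtain ⟨hb, ha⟩ := Complex.eq_neg_of_re_conj_mul_le (hbound R hR v v hv1 hv1)
    (hbound R hR w w hw1 hw1) (by linarith)
  have hSww : ⟪w, S w⟫_ℂ = ⟪v, S v⟫_ℂ := by
    rw [← hvw, hSF, inner_signOp_comm hE, signOp_signOp hE]
  rw [hSww, Complex.conj_mul', ← Complex.ofReal_pow, Complex.sub_re, Complex.add_re,
    Complex.one_re, Complex.ofReal_re] at c2
  have hSwv : ‖⟪S w, v⟫_ℂ‖ ≤ 1 := by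
    rw [← inner_conj_symm, RCLike.norm_conj]
    exact hbound S hS v w hv1 hw1
  have hc : 1 ≤ ‖⟪w, S v⟫_ℂ‖ := by
    have h1 := Complex.re_le_norm (⟪S w, v⟫_ℂ * ⟪w, S v⟫_ℂ)
    rw [norm_mul] at h1
    nlinarith [sq_nonneg ‖⟪v, S v⟫_ℂ‖, norm_nonneg ⟪w, S v⟫_ℂ]
  have hn : ∀ U ∈ unitary (H →L[ℂ] H), ∀ x : H, ‖x‖ = 1 → ‖U x‖ = 1 := fun U hU x hx => by
    rw [ContinuousLinearMap.norm_map_of_mem_unitary hU, hx]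
  have r1 := eq_inner_smul_of_norm_inner_eq_one hv1 (hn R hR v hv1) ha
  have r2 := eq_inner_smul_of_norm_inner_eq_one hw1 (hn R hR w hw1)
    (by rw [hb, norm_neg]; exact ha)
  have r3 := eq_inner_smul_of_norm_inner_eq_one hw1 (hn S hS v hv1) hc
  rw [hb] at r2
  set a := ⟪v, R v⟫_ℂ
  set c := ⟪w, S v⟫_ℂ
  have h1 := hSR' v
  rw [r1, map_smul, r3, map_smul, r2, smul_smul, smul_smul, mul_neg, neg_smul, mul_comm] at h1
  have h2 : (c * a + c * a) • w = 0 := by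
    rw [add_smul]
    nth_rewrite 1 [h1]
    exact neg_add_cancel _
  rw [smul_eq_zero, ← two_mul, mul_eq_zero, mul_eq_zero, or_iff_right two_ne_zero] at h2
  rcases h2 with (h1 | h1) | h1
  · rw [h1, norm_zero] at hc; linarith
  · rw [h1, norm_zero] at ha; linarith
  · rw [h1, norm_zero] at hw1; linarith

end Perturbation

end Deformation

section Connect

variable {H : Type u} [NormedAddCommGroup H] [InnerProductSpace ℂ H] [CompleteSpace H]

/-! ### Removing the kernel -/

/-- The Fredholm pairings of the class `(j, d)`. -/
def fredholmPairings (C : ComplexConjugation H) (j : Row) (d : Col) (S R : H →L[ℂ] H) :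
    Set ((H →L[ℂ] H) × (H →L[ℂ] H)) :=
  {p | HasSymmetries C j d S R p.1 p.2 ∧ (pairing p.1 p.2).IsFredholm}

variable {C : ComplexConjugation H} {j : Row} {d : Col} {S R P E : H →L[ℂ] H}

/-- A small `t > 0` is chosen so that the nullity has dropped at `t` and the Fredholm property holds
on all of `[0, t]`. -/
theorem exists_joinedIn_finrank_lt_of_hasDerivAt {f : ℝ → (H →L[ℂ] H) × (H →L[ℂ] H)}
    {D : H →L[ℂ] H} {v : H} (hf : Continuous f) (h0 : f 0 = (P, E))
    (hs : ∀ t, HasSymmetries C j d S R (f t).1 (f t).2) (hF : (pairing P E).IsFredholm)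
    (hD : HasDerivAt (fun t => pairing (f t).1 (f t).2) D 0) (hv : pairing P E v = 0)
    (hDv : ⟪v, D v⟫_ℂ ≠ 0) :
    ∃ q, JoinedIn (fredholmPairings C j d S R) (P, E) q ∧
      Module.finrank ℂ (pairing q.1 q.2).ker < Module.finrank ℂ (pairing P E).ker := by
  have e0 : pairing (f 0).1 (f 0).2 = pairing P E := by rw [h0]
  have hsa : ∀ t, IsSelfAdjoint (pairing (f t).1 (f t).2) := fun t =>
    isSelfAdjoint_pairing (hs t).projP (hs t).projE
  have h1 := eventually_isFredholm hD.continuousAt (hsa 0) (by rw [e0]; exact hF)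
  have h2 := eventually_finrank_ker_lt hD hsa (by rw [e0]; exact hF) (by rw [e0]; exact hv) hDv
  obtain ⟨δ, hδ, hball⟩ := Metric.eventually_nhds_iff.1 h1
  have h3 : ∀ᶠ t in 𝓝[>] (0 : ℝ), Module.finrank ℂ (pairing (f t).1 (f t).2).ker <
      Module.finrank ℂ (pairing (f 0).1 (f 0).2).ker :=
    h2.filter_mono (nhdsWithin_mono _ fun x hx => (ne_of_gt hx))
  obtain ⟨t, ht, ht0, htδ⟩ := (h3.and (Ioo_mem_nhdsGT hδ)).exists
  rw [e0] at ht
  refine ⟨f t, JoinedIn.ofLine (f := fun s => f (s * t)) (by fun_prop) (by simpa using h0)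
    (by simp) ?_, ht⟩
  rintro _ ⟨s, ⟨hs0, hs1⟩, rfl⟩
  refine ⟨hs _, hball ?_⟩
  rw [dist_zero_right, Real.norm_eq_abs, abs_of_nonneg (by positivity)]
  nlinarith

omit [CompleteSpace H] in
/-- A kernel with an antiunitary involution contains an invariant unit vector. -/
theorem exists_invariant_unit_vector (K : H →ₗ⋆[ℂ] H) (N : Submodule ℂ H) (hN : N ≠ ⊥)
    (hK : ∀ x ∈ N, K x ∈ N) (hsq : ∀ x, K (K x) = x) : ∃ v ∈ N, ‖v‖ = 1 ∧ K v = v := by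
  obtain ⟨u, hu, hu0⟩ := N.ne_bot_iff.1 hN
  obtain ⟨v, hv, hv0, hKv⟩ : ∃ v ∈ N, v ≠ 0 ∧ K v = v := by
    -- If averaging kills `u`, then `K u = -u`, and antilinearity makes `Complex.I • u` invariant.
    by_cases h : u + K u = 0
    · refine ⟨Complex.I • u, N.smul_mem _ hu, smul_ne_zero Complex.I_ne_zero hu0, ?_⟩
      rw [map_smulₛₗ, eq_neg_of_add_eq_zero_right h]
      simp
    · exact ⟨u + K u, N.add_mem hu (hK u hu), h, by rw [map_add, hsq, add_comm]⟩
  refine ⟨((‖v‖⁻¹ : ℝ) : ℂ) • v, N.smul_mem _ hv, ?_, ?_⟩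
  · rw [norm_smul, Complex.norm_real, norm_inv, norm_norm, inv_mul_cancel₀ (norm_ne_zero_iff.2 hv0)]
  · rw [map_smulₛₗ, hKv, Complex.conj_ofReal]

omit [CompleteSpace H] in
theorem planeRotation_antiunitary {J : H →ₗᵢ⋆[ℂ] H} {v w : H}
    (hJ : (J v = v ∧ J w = w) ∨ (J w = v ∧ J v = -w)) (x : H) :
    J (planeRotation v w x) = planeRotation v w (J x) := by
  rw [planeRotation_apply, planeRotation_apply, map_sub, map_smulₛₗ, map_smulₛₗ, inner_conj_symm,
    inner_conj_symm, ← inner_antilinear J, ← inner_antilinear J w]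
  rcases hJ with ⟨h1, h2⟩ | ⟨h1, h2⟩
  · rw [h1, h2]
  · rw [h1, h2, inner_neg_left]
    simp only [neg_smul, smul_neg]
    abel

theorem HasSymmetries.exists_joinedIn_finrank_lt (h : HasSymmetries C j d S R P E)
    (hF : (pairing P E).IsFredholm) (hrel : j.relation = d.relation)
    (hs : j.parity.sign * d.parity.sign * j.relation.kernelSign d.relation = 1)
    (hker : (pairing P E).ker ≠ ⊥) :
    ∃ q, JoinedIn (fredholmPairings C j d S R) (P, E) q ∧
      Module.finrank ℂ (pairing q.1 q.2).ker < Module.finrank ℂ (pairing P E).ker := by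
  set J := h.antiunitary with hJdef
  have hJP : j.relation.Commutes J P := h.commutesP
  have hJE : d.relation.Commutes J E := h.commutesE
  have hJJ : ∀ x, J (J x) = (j.parity.sign * d.parity.sign) • x := h.antiunitary_antiunitary
  obtain ⟨v, hvker, hv1, hKv⟩ := exists_invariant_unit_vector
    (kernelSymmetry J E j.relation) (pairing P E).ker hker
    (fun x hx => kernelSymmetry_mem_ker h.projP h.projE h.commutesP h.commutesE hx)
    (fun x => by rw [h.kernelSymmetry_sq, hs, one_smul])
  have hvker' : pairing P E v = 0 := hvker
  obtain ⟨hv, hw⟩ := (pairing_apply_eq_zero_iff h.projP v).1 hvker'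
  obtain ⟨w, hvw⟩ : ∃ w, signOp E v = w := ⟨_, rfl⟩
  rw [hvw] at hw
  -- In the Lagrangian case the sign condition forces `J² = -1`, so `J` acts on the pair `v, w` as a
  -- quarter turn, which still commutes with the plane rotation.
  have hJvw : (J v = v ∧ J w = w) ∨ (J w = v ∧ J v = -w) := by
    cases hr : j.relation with
    | real =>
      rw [← hrel, hr] at hJE
      rw [hr] at hKv
      have hJv : J v = v := hKv
      exact Or.inl ⟨hJv, by rw [← hvw, hJE.signOp_real, hJv]⟩
    | lagrangian =>
      rw [← hrel, hr, Relation.kernelSign, mul_neg, mul_one, neg_eq_iff_eq_neg] at hs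
      rw [hr] at hKv
      have hJw : J w = v := by rw [← hvw]; exact hKv
      exact Or.inr ⟨hJw, by rw [← hJw, hJJ, hs, neg_one_smul]⟩
  have hB := planeRotation_antiunitary hJvw
  have hRS : ∀ x, S (R x) = R (S x) := fun x => congrArg (fun A : H →L[ℂ] H => A x) h.commSR.eq
  rcases exists_first_order h.projP h.projE h.symmS.unitary h.symmR.unitary h.commSR h.commRP
    h.commSE hv1 hv hw hvw with hne | hne
  · have hsym := symmHom_generator h.symmS h.symmR h.commSR (v := v) (w := w) hB
    refine exists_joinedIn_finrank_lt_of_hasDerivAt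
      (f := fun t => (rotate (generator R v w) P t, E))
      ((continuous_rotate _ _).prodMk continuous_const) (by rw [rotate_zero])
      (fun t => h.rotateP (star_generator R v w) (commute_generator h.symmR v w) hsym t) hF
      (hasDerivAt_pairing_rotateP _ _ _) hvker' ?_
    rw [inner_deriv_rotateP h.projP h.projE (star_generator R v w) hv hw hvw]
    exact Complex.ofReal_ne_zero.2 (mul_ne_zero two_ne_zero hne)
  · have hsym := symmHom_generator h.symmR h.symmS h.commSR.symm (v := v) (w := w)
      (fun x => by rw [← hRS, ← hRS]; exact hB x)
    refine exists_joinedIn_finrank_lt_of_hasDerivAt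
      (f := fun t => (P, rotate (generator S v w) E t))
      (continuous_const.prodMk (continuous_rotate _ _)) (by rw [rotate_zero])
      (fun t => h.rotateE (star_generator S v w) (commute_generator h.symmS v w) hsym t) hF
      (hasDerivAt_pairing_rotateE _ _ _) hvker' ?_
    rw [inner_deriv_rotateE h.projP h.projE (star_generator S v w) hv hvw]
    exact Complex.ofReal_ne_zero.2 (neg_ne_zero.2 (mul_ne_zero two_ne_zero hne))

/-- If the kernel carries a real structure and both projections satisfy the same relation, then the
kernel can be removed by a homotopy. -/
theorem HasSymmetries.exists_joinedIn_ker_eq_bot (hrel : j.relation = d.relation)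
    (hs : j.parity.sign * d.parity.sign * j.relation.kernelSign d.relation = 1) (n : ℕ) :
    ∀ (P E : H →L[ℂ] H), HasSymmetries C j d S R P E → (pairing P E).IsFredholm →
      Module.finrank ℂ (pairing P E).ker = n →
      ∃ q, JoinedIn (fredholmPairings C j d S R) (P, E) q ∧ (pairing q.1 q.2).ker = ⊥ := by
  induction n using Nat.strong_induction_on with
  | _ n ih =>
    intro P E h hF hn
    by_cases hker : (pairing P E).ker = ⊥
    · exact ⟨(P, E), JoinedIn.refl ⟨h, hF⟩, hker⟩
    · obtain ⟨q, hq, hlt⟩ := h.exists_joinedIn_finrank_lt hF hrel hs hker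
      obtain ⟨q', hq', hbot⟩ := ih _ (hn ▸ hlt) q.1 q.2 hq.target_mem.1 hq.target_mem.2 rfl
      exact ⟨q', hq.trans hq', hbot⟩

/-- In the classes which are not skew, a path leads to a pairing with trivial `ℤ₂`-index. -/
theorem HasSymmetries.exists_path_indTwo_eq_zero (h : HasSymmetries C j d S R P E)
    (hF : (pairing P E).IsFredholm)
    (hs : j.parity.sign * d.parity.sign * j.relation.kernelSign d.relation = -1 ∨
      j.relation = d.relation ∧
        j.parity.sign * d.parity.sign * j.relation.kernelSign d.relation = 1) :
    ∃ Pt Et : unitInterval → (H →L[ℂ] H), IsPairingPath C j d S R Pt Et ∧ Pt 0 = P ∧ Et 0 = E ∧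
      indTwo (pairing (Pt 1) (Et 1)) = 0 := by
  obtain ⟨q, ⟨γ, hγ⟩, hq⟩ : ∃ q, JoinedIn (fredholmPairings C j d S R) (P, E) q ∧
      indTwo (pairing q.1 q.2) = 0 := by
    rcases hs with hs | ⟨hrel, hs⟩
    · exact ⟨(P, E), JoinedIn.refl ⟨h, hF⟩, h.indTwo_eq_zero hF hs⟩
    · obtain ⟨q, hq, hbot⟩ := HasSymmetries.exists_joinedIn_ker_eq_bot hrel hs _ P E h hF rfl
      exact ⟨q, hq, by rw [indTwo, hbot]; simp⟩
  refine ⟨fun t => (γ t).1, fun t => (γ t).2, ⟨by fun_prop, by fun_prop, fun t => (hγ t).1,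
    fun t => (hγ t).2⟩, ?_, ?_, ?_⟩
  · simp
  · simp
  · simpa using hq

end Connect

/-! ### Transport along unitary equivalences -/

section Transport

variable {H : Type u} [NormedAddCommGroup H] [InnerProductSpace ℂ H] [CompleteSpace H]
variable {H' : Type v} [NormedAddCommGroup H'] [InnerProductSpace ℂ H'] [CompleteSpace H']
variable {C : ComplexConjugation H} {C' : ComplexConjugation H'} {U : H ≃ₗᵢ[ℂ] H'}

theorem conjOp_conjStarAlgEquiv (hU : ∀ x, C'.map (U x) = U (C.map x)) (A : H →L[ℂ] H) :
    C'.conjOp (U.conjStarAlgEquiv A) = U.conjStarAlgEquiv (C.conjOp A) := by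
  ext x
  obtain ⟨y, rfl⟩ := U.surjective x
  simp [ComplexConjugation.conjOp_apply, hU]

theorem eigenspace_conjStarAlgEquiv (U : H ≃ₗᵢ[ℂ] H') (S : H →L[ℂ] H) (μ : ℂ) :
    Module.End.eigenspace (U.conjStarAlgEquiv S : H' →ₗ[ℂ] H') μ =
      (Module.End.eigenspace (S : H →ₗ[ℂ] H) μ).map (U.toLinearEquiv : H →ₗ[ℂ] H') := by
  ext x
  obtain ⟨y, rfl⟩ := U.surjective x
  rw [Module.End.mem_eigenspace_iff]
  constructor
  · intro h
    refine ⟨y, Module.End.mem_eigenspace_iff.2 (U.injective ?_), rfl⟩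
    simpa using h
  · rintro ⟨z, hz, hzy⟩
    have hzy' : z = y := U.injective hzy
    subst hzy'
    have := Module.End.mem_eigenspace_iff.1 hz
    simpa using congrArg U this

theorem IsSymmetryOperator.conjStarAlgEquiv {ε : Parity} {S : H →L[ℂ] H}
    (hU : ∀ x, C'.map (U x) = U (C.map x)) (h : IsSymmetryOperator C ε S) :
    IsSymmetryOperator C' ε (U.conjStarAlgEquiv S) where
  unitary := by
    have := Unitary.mem_iff.1 h.unitary
    rw [Unitary.mem_iff, ← map_star, ← map_mul, ← map_mul, this.1, this.2, map_one]
    exact ⟨rfl, rfl⟩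
  real := by rw [conjOp_conjStarAlgEquiv hU, h.real]
  squares := by
    have := h.squares
    cases ε with
    | even =>
      have h1 : S * S = 1 := this
      change U.conjStarAlgEquiv S * U.conjStarAlgEquiv S = 1
      rw [← map_mul, h1, map_one]
    | odd =>
      have h1 : S * S = -1 := this
      change U.conjStarAlgEquiv S * U.conjStarAlgEquiv S = -1
      rw [← map_mul, h1, map_neg, map_one]
  eigenspaces μ ν hμ hν := by
    have hev : ∀ μ, Module.End.HasEigenvalue (U.conjStarAlgEquiv S : H' →ₗ[ℂ] H') μ →
        Module.End.HasEigenvalue (S : H →ₗ[ℂ] H) μ := by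
      intro μ hμ
      rw [Module.End.hasEigenvalue_iff] at hμ ⊢
      intro hbot
      rw [eigenspace_conjStarAlgEquiv, hbot, Submodule.map_bot] at hμ
      exact hμ rfl
    obtain ⟨e⟩ := h.eigenspaces μ ν (hev μ hμ) (hev ν hν)
    rw [eigenspace_conjStarAlgEquiv, eigenspace_conjStarAlgEquiv]
    exact ⟨(U.submoduleMap _).symm.trans (e.trans (U.submoduleMap _))⟩

theorem Relation.Holds.conjStarAlgEquiv {r : Relation} {S P : H →L[ℂ] H}
    (hU : ∀ x, C'.map (U x) = U (C.map x)) (h : r.Holds C S P) :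
    r.Holds C' (U.conjStarAlgEquiv S) (U.conjStarAlgEquiv P) := by
  cases r with
  | real =>
    have h1 : star S * C.conjOp P * S = P := h
    change star _ * C'.conjOp _ * _ = _
    rw [conjOp_conjStarAlgEquiv hU, ← map_star, ← map_mul, ← map_mul, h1]
  | lagrangian =>
    have h1 : star S * C.conjOp P * S = 1 - P := h
    change star _ * C'.conjOp _ * _ = 1 - _
    rw [conjOp_conjStarAlgEquiv hU, ← map_star, ← map_mul, ← map_mul, h1, map_sub, map_one]

theorem HasSymmetries.conjStarAlgEquiv {j : Row} {d : Col} {S R P E : H →L[ℂ] H}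
    (hU : ∀ x, C'.map (U x) = U (C.map x)) (h : HasSymmetries C j d S R P E) :
    HasSymmetries C' j d (U.conjStarAlgEquiv S) (U.conjStarAlgEquiv R) (U.conjStarAlgEquiv P)
      (U.conjStarAlgEquiv E) where
  projP := h.projP.map _
  projE := h.projE.map _
  symmS := h.symmS.conjStarAlgEquiv hU
  symmR := h.symmR.conjStarAlgEquiv hU
  commSR := h.commSR.map _
  commRP := h.commRP.map _
  commSE := h.commSE.map _
  relP := h.relP.conjStarAlgEquiv hU
  relE := h.relE.conjStarAlgEquiv hU

theorem pairing_conjStarAlgEquiv (U : H ≃ₗᵢ[ℂ] H') (P E : H →L[ℂ] H) :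
    pairing (U.conjStarAlgEquiv P) (U.conjStarAlgEquiv E) =
      U.conjStarAlgEquiv (pairing P E) := by
  simp [pairing]

theorem isFredholm_conjStarAlgEquiv (U : H ≃ₗᵢ[ℂ] H') {T : H →L[ℂ] H} (hT : T.IsFredholm) :
    (U.conjStarAlgEquiv T).IsFredholm := by
  obtain ⟨V, hV⟩ := hT.exists_isQuasiInverse
  refine ContinuousLinearMap.IsFredholm.of_isQuasiInverse (v := U.conjStarAlgEquiv V) ?_
  have h1 : LinearMap.IsQuasiInverse (U.symm.toLinearEquiv : H' →ₗ[ℂ] H)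
      (U.toLinearEquiv : H →ₗ[ℂ] H') := U.toLinearEquiv.isQuasiInverse
  exact (h1.symm.comp hV).comp h1

end Transport

/-! ### Augmentation by the zero space and realization of the entries -/

section Augmentation

variable {H : Type u} [NormedAddCommGroup H] [InnerProductSpace ℂ H] [CompleteSpace H]
variable {K : Type v} [NormedAddCommGroup K] [InnerProductSpace ℂ K] [CompleteSpace K]

/-- The unitary `H ≃ H ⊕ K` for a trivial space `K`. -/
def dsumUnique (H : Type u) [NormedAddCommGroup H] [InnerProductSpace ℂ H]
    (K : Type v) [NormedAddCommGroup K] [InnerProductSpace ℂ K] [Subsingleton K] :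
    H ≃ₗᵢ[ℂ] WithLp 2 (H × K) where
  toFun x := WithLp.toLp 2 (x, 0)
  invFun x := x.fst
  left_inv _ := rfl
  right_inv x := by
    apply (WithLp.prodContinuousLinearEquiv 2 ℂ H K).injective
    exact Prod.ext rfl (Subsingleton.elim _ _)
  map_add' x y := by
    apply (WithLp.prodContinuousLinearEquiv 2 ℂ H K).injective
    simp
  map_smul' c x := by
    apply (WithLp.prodContinuousLinearEquiv 2 ℂ H K).injective
    simp
  norm_map' x := by
    change ‖WithLp.toLp 2 ((x, 0) : H × K)‖ = ‖x‖
    rw [WithLp.prod_norm_eq_of_L2]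
    simp

theorem dsum_eq_conjStarAlgEquiv [Subsingleton K] (A : H →L[ℂ] H) (B : K →L[ℂ] K) :
    dsum A B = (dsumUnique H K).conjStarAlgEquiv A := by
  ext x
  apply (WithLp.prodContinuousLinearEquiv 2 ℂ H K).injective
  exact Prod.ext rfl (Subsingleton.elim _ _)

theorem hasSymmetries_of_subsingleton [Subsingleton K] (C : ComplexConjugation K) (j : Row)
    (d : Col) (S R P E : K →L[ℂ] K) : HasSymmetries C j d S R P E := by
  have hsub : ∀ A B : K →L[ℂ] K, A = B := fun A B => by
    ext x; exact Subsingleton.elim _ _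
  have hsymm : ∀ (ε : Parity) (S : K →L[ℂ] K), IsSymmetryOperator C ε S := fun ε S =>
    { unitary := Unitary.mem_iff.2 ⟨hsub _ _, hsub _ _⟩
      real := hsub _ _
      squares := by cases ε <;> exact hsub _ _
      eigenspaces := fun μ ν hμ _ => by
        rw [Module.End.hasEigenvalue_iff] at hμ
        exact absurd (Subsingleton.elim _ _) hμ }
  have hrel : ∀ (r : Relation) (S P : K →L[ℂ] K), r.Holds C S P := fun r S P => by
    cases r <;> exact hsub _ _
  exact ⟨⟨hsub _ _, hsub _ _⟩, ⟨hsub _ _, hsub _ _⟩, hsymm _ _, hsymm _ _, hsub _ _, hsub _ _,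
    hsub _ _, hrel _ _ _, hrel _ _ _⟩

theorem HasSymmetries.hasTrivialIndex {C : ComplexConjugation H} {j : Row} {d : Col}
    {S R P E : H →L[ℂ] H} (h : HasSymmetries C j d S R P E) (hF : (pairing P E).IsFredholm)
    (hs : j.parity.sign * d.parity.sign * j.relation.kernelSign d.relation = -1 ∨
      j.relation = d.relation ∧
        j.parity.sign * d.parity.sign * j.relation.kernelSign d.relation = 1) :
    HasTrivialIndex C j d S R P E := by
  -- The augmenting space is `ℂ⁰`, where all operators coincide and every relation holds; the path
  -- is built directly on the unitarily equivalent space `H ⊕ ℂ⁰`.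
  refine ⟨ind_pairing h.projP h.projE, 0, 1, 1, 1, 1,
    hasSymmetries_of_subsingleton _ _ _ _ _ _ _, ?_, ?_⟩
  · ext x; exact congrArg (fun y : EuclideanSpace ℂ (Fin 0) => y _) (Subsingleton.elim _ _)
  have hU : ∀ x, (C.dsum (stdConj 0)).map (dsumUnique H (EuclideanSpace ℂ (Fin 0)) x) =
      dsumUnique H (EuclideanSpace ℂ (Fin 0)) (C.map x) := by
    intro x
    apply (WithLp.prodContinuousLinearEquiv 2 ℂ H (EuclideanSpace ℂ (Fin 0))).injective
    exact Prod.ext rfl (Subsingleton.elim _ _)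
  have h' := h.conjStarAlgEquiv hU
  have hF' := isFredholm_conjStarAlgEquiv (dsumUnique H (EuclideanSpace ℂ (Fin 0))) hF
  rw [← pairing_conjStarAlgEquiv] at hF'
  simp only [dsum_eq_conjStarAlgEquiv]
  exact h'.exists_path_indTwo_eq_zero hF' hs

theorem HasSymmetries.hasZ2Index {C : ComplexConjugation H} {j : Row} {d : Col} {ε : Parity}
    {S R P E : H →L[ℂ] H} (h : HasSymmetries C j d S R P E) (hs : IsSkewClass j d)
    (hj : j.parity = ε) (hd : d.parity = ε) : HasZ2Index C j d ε S R P E where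
  type := by
    refine ⟨hj ▸ h.symmS, hd ▸ h.symmR, ?_⟩
    cases hs with
    | of_real hr hr' _ => exact Or.inr ⟨hr ▸ h.relP, hr' ▸ h.relE⟩
    | of_lagrangian hr hr' _ => exact Or.inl ⟨hr ▸ h.relP, hr' ▸ h.relE⟩
  ind_eq_zero := ind_pairing h.projP h.projE
  homotopy_invariant Pt Et hpath hP hE t := by
    rw [← hP, ← hE]
    exact hpath.indTwo_eq hs t 0

end Augmentation

end IndexPairing

end

/-! ### Case distinction over the table -/

theorem mainTheorem3 {H : Type*} [NormedAddCommGroup H] [InnerProductSpace ℂ H] [CompleteSpace H]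
    (C : IndexPairing.ComplexConjugation H) (j : IndexPairing.Row) (d : IndexPairing.Col)
    (S R P E : H →L[ℂ] H) (h : IndexPairing.HasSymmetries C j d S R P E)
    (hT : (IndexPairing.pairing P E).IsFredholm) :
    (IndexPairing.table j d).IsRealized C j d S R P E ∧
    (IndexPairing.table j d = .zero →
      (j, d) ∉ ({(.j0, .d1), (.j2, .d3), (.j4, .d5), (.j6, .d7)} :
        Set (IndexPairing.Row × IndexPairing.Col)) →
      IndexPairing.indTwo (IndexPairing.pairing P E) = 0) := by
  open IndexPairing in
  cases j <;> cases d
  case j0.d7 | j4.d3 =>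
    exact ⟨h.hasZ2Index (.of_real rfl rfl
      (by simp [Row.parity, Col.parity, Parity.sign])) rfl rfl, fun h0 => nomatch h0⟩
  case j2.d1 | j6.d5 =>
    exact ⟨h.hasZ2Index (.of_lagrangian rfl rfl
      (by simp [Row.parity, Col.parity, Parity.sign])) rfl rfl, fun h0 => nomatch h0⟩
  -- Equal relations with `K² = 1`: the kernel is only removable by a homotopy.
  case j0.d1 | j2.d3 | j4.d5 | j6.d7 =>
    exact ⟨h.hasTrivialIndex hT (Or.inr ⟨rfl, by simp [Row.parity, Col.parity, Row.relation,
      Col.relation, Parity.sign, Relation.kernelSign]⟩), fun _ h0 => absurd (by simp) h0⟩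
  -- In the eight remaining classes `K² = -1`, so the kernel is quaternionic.
  all_goals
    refine (fun hs => ⟨h.hasTrivialIndex hT (Or.inl hs), fun _ _ => h.indTwo_eq_zero hT hs⟩) ?_
    simp [Row.parity, Col.parity, Row.relation, Col.relation, Parity.sign, Relation.kernelSign]
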